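/- **Setting.** The Gerdjikov–Ivanov (GI) equation is $$ i q_t+q_{xx}-iq^2\bar q_x+\tfrac12 q^3\bar q^2=0 .$$ Put $\sigma_3=\mathrm{diag}(1,-1)$, $Q=\begin{pmatrix}0&q\\-\bar q&0\end{pmatrix}$, $U=kQ-\frac i2Q^2\sigma_3$ and $V=2k^3Q-ik^2Q^2\sigma_3-ikQ_x\sigma_3+\frac12(Q_xQ-QQ_x)+\frac i4Q^4\sigma_3$. Let $S\subset\mathbb C$ be open and invariant under $k\mapsto-k$ and $k\mapsto\bar k$. Let $q_0$ be a smooth solution of the GI equation on $\mathbb R^2$, and let $\psi_0(x,t,k)$, $k\in S$, be a $2\times2$ matrix function that is smooth in $(x,t,k)$, holomorphic in $k$, and satisfies, with $q=q_0$, $$\psi_x+ik^2\sigma_3\psi=U\psi,\quad \psi_t+2ik^4\sigma_3\psi=V\psi,\quad \sigma_3\psi(-k)\sigma_3=\psi(k),\quad \psi(k)^{-1}=\psi(\bar k)^\dagger .$$ Let $k_1,\dots,k_N\in S$ satisfy $k_j^2\ne\bar k_j^2$ for all $j$, and $k_i^2\ne k_j^2$, $k_i^2\neq\bar k_j^2$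 for $i\ne j$. Let $\Upsilon_j\neq0$ and $\tilde\Upsilon_j$ be constant row vectors in $\mathbb C^2$ ($1\le j\le N$). **Construction.** For $j=1,\dots,N$, given $\psi_{j-1}$, put $$\langle y_j|=\Upsilon_j\psi_{j-1}^{-1}(k_j),\qquad \langle\tilde y_j|=\tilde\Upsilon_j\psi_{j-1}^{-1}(k_j)+\Upsilon_j\,\tfrac{d}{dk}\psi_{j-1}^{-1}(k)\big|_{k=k_j},$$ $|y_j\rangle=\langle y_j|^\dagger$, $|\tilde y_j\rangle=\langle\tilde y_j|^\dagger$. Write $y^1=y_j$, $y^2=\tilde y_j$, $\gamma_j=k_j^2-\bar k_j^2$ and, for $m,n\in\{1,2\}$, $P^\pm_{mn}=\langle y^m|(I\pm\sigma_3)|y^n\rangle$; define $$a^\pm_{mn}=k_jP^\pm_{mn}+\bar k_jP^\mp_{mn},\quad b^\pm_{mn}=(k_j^2+\bar k_j^2)P^\pm_{mn}+2k_j\bar k_jP^\mp_{mn},$$ $$c^\pm_{11}=(k_j^3+3k_j\bar k_j^2)P^\pm_{11}+(\bar k_j^3+3\bar k_jk_j^2)P^\mp_{11},$$ $$\Delta_j^\pm=\gamma_j^2(a_{21}^\pm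 a_{12}^\pm-a_{11}^\pm a_{22}^\pm)+2a_{11}^\pm c_{11}^\mp-b_{11}^\pm b_{11}^\mp+\gamma_j\big[a_{21}^\pm b_{11}^\mp-a_{12}^\pm b_{11}^\pm+a_{11}^\pm(b_{12}^\pm-b_{21}^\mp)\big].$$ Let $\Lambda_j,\Omega_j,\tilde\Lambda_j,\tilde\Omega_j$ be the diagonal matrices whose first (upper sign) and second (lower sign) diagonal entries are $$-\frac{\gamma_j^3}{\Delta_j^\pm}a_{11}^\pm,\qquad \frac{\gamma_j^2}{\Delta_j^\pm}\big[\gamma_ja_{12}^\pm+b_{11}^\mp\big],\qquad \frac{\gamma_j^2}{\Delta_j^\pm}\big[\gamma_ja_{21}^\pm-b_{11}^\pm\big],\qquad \frac{\gamma_j}{\Delta_j^\pm}\big[-\gamma_j^2a_{22}^\pm+\gamma_j(b_{12}^\pm-b_{21}^\mp)+2c_{11}^\mp\big]$$ respectively. Put $|z_j\rangle=\Lambda_j|\tilde y_j\rangle+\Omega_j|y_j\rangle$, $|\tilde z_j\rangle=\tilde\Lambda_j|\tilde y_j\rangle+\tilde\Omega_j|y_j\rangle$, $B_j=|z_j\rangle\langle\tilde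 y_j|+|\tilde z_j\rangle\langle y_j|$, $\tilde B_j=|z_j\rangle\langle y_j|$, $$D_j(k)=I+\frac{B_j}{k-k_j}-\frac{\sigma_3B_j\sigma_3}{k+k_j}+\frac{\tilde B_j}{(k-k_j)^2}+\frac{\sigma_3\tilde B_j\sigma_3}{(k+k_j)^2},\qquad \psi_j=D_j\psi_{j-1}.$$ Let $\psi=\psi_N=G\psi_0$, $G=D_N\cdots D_1$, and let $\mathcal P=\{\pm k_j,\pm\bar k_j\}_{j=1}^N$. **Claim.** 1. All $\Delta_j^\pm(x,t)$ are nonzero, and for $k\notin\mathcal P$ $$D_j^{-1}(k)=I+\frac{B_j^\dagger}{k-\bar k_j}-\frac{\sigma_3B_j^\dagger\sigma_3}{k+\bar k_j}+\frac{\tilde B_j^\dagger}{(k-\bar k_j)^2}+\frac{\sigma_3\tilde B_j^\dagger\sigma_3}{(k+\bar k_j)^2};$$ for $k\in S\setminus\mathcal P$, $\psi$ is invertible and differentiable in $x$ and in $t$. 2. For all $x,t$, the functions $\psi_x\psi^{-1}$ and $\psi_t\psi^{-1}$ of $k$ are analytic (after removal of the singularity) at every point of $\mathcal P$. 3. $G$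 has an expansion $$G=I+\sum_{j=1}^N\Big[\frac{A_j}{k-k_j}-\frac{\sigma_3A_j\sigma_3}{k+k_j}+\frac{\tilde A_j}{(k-k_j)^2}+\frac{\sigma_3\tilde A_j\sigma_3}{(k+k_j)^2}\Big]$$ with matrices $A_j(x,t),\tilde A_j(x,t)$, and $q=q_0+4i\sum_{j=1}^N(A_j)_{12}$ is a smooth solution of the GI equation. -/

import Mathlib

open Matrix Filter Topology
open scoped ContDiff ComplexConjugate

noncomputable section

namespace GerdjikovIvanov

/-- Complex `2 × 2` matrices. -/
abbrev Mat := Matrix (Fin 2) (Fin 2) ℂ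

/-- Row or column vectors with two complex entries. -/
abbrev Vec := Fin 2 → ℂ

/-- The Pauli matrix `σ₃ = diag(1, -1)`. -/
def sigma3 : Mat := !![1, 0; 0, -1]

/-! ### The equation and its Lax pair -/

/-- `q(x,t)` is a smooth solution of the Gerdjikov-Ivanov equation
`i q_t + q_xx - i q² (q̄)_x + (1/2) q³ q̄² = 0`. -/
structure IsGISolution (q : ℝ → ℝ → ℂ) : Prop where
  smooth : ContDiff ℝ ∞ (fun p : ℝ × ℝ => q p.1 p.2)
  eqn : ∀ x t : ℝ,
    Complex.I * deriv (fun t' => q x t') t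
      + deriv (fun x' => deriv (fun x'' => q x'' t) x') x
      - Complex.I * q x t ^ 2 * deriv (fun x' => conj (q x' t)) x
      + (1 / 2) * q x t ^ 3 * conj (q x t) ^ 2 = 0

/-- Entrywise derivative of a matrix function of a real variable. -/
def realDeriv (F : ℝ → Mat) (x : ℝ) : Mat :=
  Matrix.of fun a b => deriv (fun x' => F x' a b) x

/-- Entrywise derivative of a matrix function of a complex variable. -/
def cplxDeriv (F : ℂ → Mat) (κ : ℂ) : Mat :=
  Matrix.of fun a b => deriv (fun κ' => F κ' a b) κ

/-- The matrix `Q = [[0, q], [-q̄, 0]]`. -/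
def potential (q : ℝ → ℝ → ℂ) (x t : ℝ) : Mat := !![0, q x t; -conj (q x t), 0]

/-- `U = k Q - (i/2) Q² σ₃`. -/
def laxU (q : ℝ → ℝ → ℂ) (x t : ℝ) (κ : ℂ) : Mat :=
  κ • potential q x t - (Complex.I / 2) • (potential q x t ^ 2 * sigma3)

/-- `V = 2k³ Q - i k² Q² σ₃ - i k Q_x σ₃ + (1/2) (Q_x Q - Q Q_x) + (i/4) Q⁴ σ₃`. -/
def laxV (q : ℝ → ℝ → ℂ) (x t : ℝ) (κ : ℂ) : Mat :=
  let Q := potential q x t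
  let Qx := realDeriv (fun x' => potential q x' t) x
  (2 * κ ^ 3) • Q - (Complex.I * κ ^ 2) • (Q ^ 2 * sigma3) - (Complex.I * κ) • (Qx * sigma3)
    + (1 / 2 : ℂ) • (Qx * Q - Q * Qx) + (Complex.I / 4) • (Q ^ 4 * sigma3)

/-- `ψ(x,t,k)`, for `k` in `S`, is a regular matrix eigenfunction of the Lax pair with potential
`q`, normalised by `σ₃ ψ(-k) σ₃ = ψ(k)` and `ψ(k)⁻¹ = ψ(k̄)†`. Regular means smooth in all the
variables and holomorphic in `k`. -/
structure IsEigenfunction (S : Set ℂ) (q : ℝ → ℝ → ℂ) (ψ : ℝ → ℝ → ℂ → Mat) : Prop where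
  smooth : ∀ a b, ContDiffOn ℝ ∞ (fun p : ℝ × ℝ × ℂ => ψ p.1 p.2.1 p.2.2 a b)
    (Set.univ ×ˢ Set.univ ×ˢ S)
  holo : ∀ (x t : ℝ) (a b : Fin 2), DifferentiableOn ℂ (fun κ => ψ x t κ a b) S
  lax_x : ∀ (x t : ℝ), ∀ κ ∈ S,
    realDeriv (fun x' => ψ x' t κ) x + (Complex.I * κ ^ 2) • (sigma3 * ψ x t κ)
      = laxU q x t κ * ψ x t κ
  lax_t : ∀ (x t : ℝ), ∀ κ ∈ S,
    realDeriv (fun t' => ψ x t' κ) t + (2 * Complex.I * κ ^ 4) • (sigma3 * ψ x t κ)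
      = laxV q x t κ * ψ x t κ
  parity : ∀ (x t : ℝ), ∀ κ ∈ S, sigma3 * ψ x t (-κ) * sigma3 = ψ x t κ
  unitarity : ∀ (x t : ℝ), ∀ κ ∈ S, ψ x t κ * (ψ x t (conj κ))ᴴ = 1

/-! ### The scalars of one dressing step

A row vector `⟨y|` is given by its entries `y`, and `|y⟩ = ⟨y|†`. The argument `s` is the sign
`±1` of the superscript `±`, and `p` is the pole. -/

/-- `⟨u| (I + s σ₃) |v⟩`. -/
def pairing (s : ℂ) (u v : Vec) : ℂ := u ⬝ᵥ ((1 + s • sigma3) *ᵥ star v)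

/-- `p ⟨u|(I + s σ₃)|v⟩ + p̄ ⟨u|(I - s σ₃)|v⟩`; the `a` scalars. -/
def aCoef (p s : ℂ) (u v : Vec) : ℂ := p * pairing s u v + conj p * pairing (-s) u v

/-- `(p² + p̄²) ⟨u|(I + s σ₃)|v⟩ + 2 p p̄ ⟨u|(I - s σ₃)|v⟩`; the `b` scalars. -/
def bCoef (p s : ℂ) (u v : Vec) : ℂ :=
  (p ^ 2 + conj p ^ 2) * pairing s u v + 2 * p * conj p * pairing (-s) u v

/-- `(p³ + 3 p p̄²) ⟨u|(I + s σ₃)|v⟩ + (p̄³ + 3 p̄ p²) ⟨u|(I - s σ₃)|v⟩`; the `c` scalars. -/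
def cCoef (p s : ℂ) (u v : Vec) : ℂ :=
  (p ^ 3 + 3 * p * conj p ^ 2) * pairing s u v
    + (conj p ^ 3 + 3 * conj p * p ^ 2) * pairing (-s) u v

/-- The difference `p² - p̄²`. -/
def gap (p : ℂ) : ℂ := p ^ 2 - conj p ^ 2

/-- The denominator `Δ^±`; the index `1` stands for `y`, the index `2` for `w` (that is, `ỹ`). -/
def delta (p s : ℂ) (y w : Vec) : ℂ :=
  gap p ^ 2 * (aCoef p s w y * aCoef p s y w - aCoef p s y y * aCoef p s w w)
    + 2 * aCoef p s y y * cCoef p (-s) y y - bCoef p s y y * bCoef p (-s) y y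
    + gap p * (aCoef p s w y * bCoef p (-s) y y - aCoef p s y w * bCoef p s y y
      + aCoef p s y y * (bCoef p s y w - bCoef p (-s) w y))

/-- Entry of the diagonal matrix `Λ`: the first for `s = 1`, the second for `s = -1`. -/
def lambdaEntry (p s : ℂ) (y w : Vec) : ℂ :=
  -(gap p ^ 3 / delta p s y w) * aCoef p s y y

/-- Entry of the diagonal matrix `Ω`. -/
def omegaEntry (p s : ℂ) (y w : Vec) : ℂ :=
  gap p ^ 2 / delta p s y w * (gap p * aCoef p s y w + bCoef p (-s) y y)

/-- Entry of the diagonal matrix `Λ̃`. -/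
def lambdaTildeEntry (p s : ℂ) (y w : Vec) : ℂ :=
  gap p ^ 2 / delta p s y w * (gap p * aCoef p s w y - bCoef p s y y)

/-- Entry of the diagonal matrix `Ω̃`. -/
def omegaTildeEntry (p s : ℂ) (y w : Vec) : ℂ :=
  gap p / delta p s y w * (-(gap p ^ 2) * aCoef p s w w
    + gap p * (bCoef p s y w - bCoef p (-s) w y) + 2 * cCoef p (-s) y y)

/-- The matrix `diag(f(1), f(-1))`. -/
def signDiag (f : ℂ → ℂ) : Mat := Matrix.diagonal ![f 1, f (-1)]

/-- The column vector `|z⟩ = Λ |ỹ⟩ + Ω |y⟩`. -/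
def zVec (p : ℂ) (y w : Vec) : Vec :=
  signDiag (fun s => lambdaEntry p s y w) *ᵥ star w
    + signDiag (fun s => omegaEntry p s y w) *ᵥ star y

/-- The column vector `|z̃⟩ = Λ̃ |ỹ⟩ + Ω̃ |y⟩`. -/
def zTildeVec (p : ℂ) (y w : Vec) : Vec :=
  signDiag (fun s => lambdaTildeEntry p s y w) *ᵥ star w
    + signDiag (fun s => omegaTildeEntry p s y w) *ᵥ star y

/-- `B = (|z⟩, |z̃⟩) (⟨ỹ| ; ⟨y|) = |z⟩⟨ỹ| + |z̃⟩⟨y|`. -/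
def bMat (p : ℂ) (y w : Vec) : Mat :=
  Matrix.vecMulVec (zVec p y w) w + Matrix.vecMulVec (zTildeVec p y w) y

/-- `B̃ = (|z⟩, |z̃⟩) σ₊ (⟨ỹ| ; ⟨y|) = |z⟩⟨y|`. -/
def bTildeMat (p : ℂ) (y w : Vec) : Mat := Matrix.vecMulVec (zVec p y w) y

/-- `B/(k-p) - σ₃Bσ₃/(k+p) + B̃/(k-p)² + σ₃B̃σ₃/(k+p)²`. -/
def polePart (p : ℂ) (B B' : Mat) (κ : ℂ) : Mat :=
  (1 / (κ - p)) • B - (1 / (κ + p)) • (sigma3 * B * sigma3)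
    + (1 / (κ - p) ^ 2) • B' + (1 / (κ + p) ^ 2) • (sigma3 * B' * sigma3)

/-! ### The iterated dressing

Here `x` and `t` are fixed, and `Ψ` is an eigenfunction as a function of the spectral parameter.
The sequences `k`, `Υ`, `Υ'` are numbered from `0`: their entry at `j` belongs to the step from
`ψ_j` to `ψ_(j+1)`. -/

/-- `⟨y| = Υ Ψ⁻¹(p)`. -/
def yVec (p : ℂ) (Υ : Vec) (Ψ : ℂ → Mat) : Vec := Υ ᵥ* (Ψ p)⁻¹

/-- `⟨ỹ| = Υ' Ψ⁻¹(p) + Υ (Ψ⁻¹)'(p)`. -/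
def yTildeVec (p : ℂ) (Υ Υ' : Vec) (Ψ : ℂ → Mat) : Vec :=
  Υ' ᵥ* (Ψ p)⁻¹ + Υ ᵥ* cplxDeriv (fun κ => (Ψ κ)⁻¹) p

/-- The dressing factor `D` built from the eigenfunction `Ψ`. -/
def stepFactor (p : ℂ) (Υ Υ' : Vec) (Ψ : ℂ → Mat) (κ : ℂ) : Mat :=
  1 + polePart p (bMat p (yVec p Υ Ψ) (yTildeVec p Υ Υ' Ψ))
    (bTildeMat p (yVec p Υ Ψ) (yTildeVec p Υ Υ' Ψ)) κ

/-- The expected inverse of `D`: the same expression with `p̄`, `B†`, `B̃†`. -/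
def stepFactorInv (p : ℂ) (Υ Υ' : Vec) (Ψ : ℂ → Mat) (κ : ℂ) : Mat :=
  1 + polePart (conj p) (bMat p (yVec p Υ Ψ) (yTildeVec p Υ Υ' Ψ))ᴴ
    (bTildeMat p (yVec p Υ Ψ) (yTildeVec p Υ Υ' Ψ))ᴴ κ

/-- The dressed eigenfunctions: `ψ_0 = Ψ`, `ψ_(j+1) = D_(j+1) ψ_j`, where `D_(j+1)` is built
from `ψ_j`. -/
def dressed (k : ℕ → ℂ) (Υ Υ' : ℕ → Vec) (Ψ : ℂ → Mat) : ℕ → ℂ → Mat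
  | 0 => Ψ
  | j + 1 => fun κ =>
      stepFactor (k j) (Υ j) (Υ' j) (dressed k Υ Υ' Ψ j) κ * dressed k Υ Υ' Ψ j κ

/-- The product `D_N ⋯ D_1`. -/
def dressingProduct (k : ℕ → ℂ) (Υ Υ' : ℕ → Vec) (Ψ : ℂ → Mat) : ℕ → ℂ → Mat
  | 0 => fun _ => 1
  | j + 1 => fun κ =>
      stepFactor (k j) (Υ j) (Υ' j) (dressed k Υ Υ' Ψ j) κ * dressingProduct k Υ Υ' Ψ j κ

/-- The set of the points `±k_j`, `±k̄_j`, for the first `N` terms of the sequence. -/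
def poleSet (k : ℕ → ℂ) (N : ℕ) : Set ℂ :=
  {κ | ∃ j < N, κ = k j ∨ κ = -k j ∨ κ = conj (k j) ∨ κ = -conj (k j)}

/-- A matrix function, defined near `p` except perhaps at `p`, is analytic at `p` (after
removal of the singularity). -/
def AnalyticAfterRemoval (F : ℂ → Mat) (p : ℂ) : Prop :=
  ∃ H : ℂ → Mat, (∀ a b, AnalyticAt ℂ (fun κ => H κ a b) p) ∧ ∀ᶠ κ in 𝓝[≠] p, F κ = H κ

end GerdjikovIvanov

end

open GerdjikovIvanov

/-!
Each dressing step is a Darboux transformation with a double pole at `p`. The row vectors `y` and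
`ỹ` (written `w` in the lemmas) are the value and the first derivative at `p` of
`(Υ + (κ - p) Υ̃) ψ⁻¹(κ)`, and near `p` the factor `D` is
`(z / (κ - p)² + z̃ / (κ - p)) (y + (κ - p) ỹ)` up to a regular term. The formulas for `z`, `z̃` say
that `D` annihilates the jet `y† + (κ - p̄) ỹ†` at `p̄` to first order. This is a linear system whose
determinant is `Δ^± / γ⁴` (`rowValue_eq`, `rowSlope_eq`). Its skew part is the Gram form of the
kernel `1 / (κ - λ̄)`, which is definite on jets with `y ≠ 0`, so the system is nondegenerate
(`row_injective`, `delta_ne_zero`). By partial fractions (`polePart_mul_polePart`) the vanishing of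
the jet yields `D(κ) D(κ̄)† = 1`, which is the formula for the inverse (`dressing_mul_inverse`).

Suppose that `ψ` obeys `ψ_s = L ψ` with a polynomial `L` in `κ`, where `s` is `x` or `t`. Let `M` be
another polynomial for which the polynomial parts of `D L` and `M D` at infinity agree
(`Matching`). Then `D_s + D L - M D` is a pole part with the row space of `D`, and it annihilates the
same jet at `p̄`, because `y† + (κ - p̄) ỹ†` obeys the Lax equation to first order. Nondegeneracy of
the linear system makes it zero (`residue_flow`), so `D ψ` obeys the Lax equation with `M`
(`dressed_flow`). For the potential `q + 4 i B₁₂` the matching is a polynomial identity in the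
entries of `B`, `B̃` and `p` (`matching_x`, `matching_t`); the second one uses the flow of `B` in `x`.
Hence a step turns eigenfunctions into eigenfunctions, away from the new poles
(`IsEigenfunction.dress`), and by zero curvature the new potential is a solution
(`IsEigenfunction.isGISolution`).

Induction on the number of steps gives an eigenfunction on `S` without the poles
(`dressed_isEigenfunction`). There `ψ_x ψ⁻¹` and `ψ_t ψ⁻¹` are polynomials in `κ`, so their
singularities at the poles are removable. The product of the factors is expanded one factor at a
time (`dressingProduct_expansion`). The sum of the upper right entries of the residues at the `k_j`
is half the upper right entry of the coefficient of `1 / κ` at infinity, so it grows by `B₁₂` in each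
step, and the potential obtained by the induction is the stated one.
-/

noncomputable section

namespace GerdjikovIvanov

/-! ### Entries of a pole part -/

/-- The diagonal entries `1, -1` of `σ₃`. -/
def sgn (i : Fin 2) : ℂ := ![1, -1] i

@[simp] lemma sgn_zero : sgn 0 = 1 := rfl
@[simp] lemma sgn_one : sgn 1 = -1 := rfl

lemma sgn_mul_self (i : Fin 2) : sgn i * sgn i = 1 := by
  fin_cases i <;> simp

@[simp] lemma conj_sgn (i : Fin 2) : conj (sgn i) = sgn i := by
  fin_cases i <;> simp

lemma sigma3_conj_apply (B : Mat) (i j : Fin 2) :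
    (sigma3 * B * sigma3) i j = sgn i * sgn j * B i j := by
  fin_cases i <;> fin_cases j <;>
    simp [sigma3, Matrix.mul_apply, Matrix.vecMul, dotProduct, Fin.sum_univ_two]

/-- An entry of `polePart`: the sign `s` is `1` on the diagonal and `-1` off the diagonal. -/
def scalarPole (p s b b' κ : ℂ) : ℂ :=
  b / (κ - p) - s * b / (κ + p) + b' / (κ - p) ^ 2 + s * b' / (κ + p) ^ 2

/-- The derivative of `scalarPole` in the last variable. -/
def scalarPoleDeriv (p s b b' κ : ℂ) : ℂ :=
  -b / (κ - p) ^ 2 + s * b / (κ + p) ^ 2 - 2 * b' / (κ - p) ^ 3 - 2 * s * b' / (κ + p) ^ 3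

lemma polePart_apply (p : ℂ) (B B' : Mat) (κ : ℂ) (i j : Fin 2) :
    polePart p B B' κ i j = scalarPole p (sgn i * sgn j) (B i j) (B' i j) κ := by
  simp only [polePart, scalarPole, Matrix.add_apply, Matrix.sub_apply, Matrix.smul_apply,
    sigma3_conj_apply, smul_eq_mul]
  ring

/-- The derivative of `polePart` in the spectral parameter. -/
def polePartDeriv (p : ℂ) (B B' : Mat) (κ : ℂ) : Mat :=
  Matrix.of fun i j => scalarPoleDeriv p (sgn i * sgn j) (B i j) (B' i j) κ

lemma polePartDeriv_apply (p : ℂ) (B B' : Mat) (κ : ℂ) (i j : Fin 2) :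
    polePartDeriv p B B' κ i j = scalarPoleDeriv p (sgn i * sgn j) (B i j) (B' i j) κ := rfl

lemma hasDerivAt_scalarPole (p s b b' κ : ℂ) (h : κ - p ≠ 0) (h' : κ + p ≠ 0) :
    HasDerivAt (scalarPole p s b b') (scalarPoleDeriv p s b b' κ) κ := by
  have h1 : HasDerivAt (fun κ => κ - p) 1 κ := (hasDerivAt_id κ).sub_const p
  have h2 : HasDerivAt (fun κ => κ + p) 1 κ := (hasDerivAt_id κ).add_const p
  have e := ((((hasDerivAt_const κ b).div h1 h).sub ((hasDerivAt_const κ (s * b)).div h2 h')).add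
    ((hasDerivAt_const κ b').div (h1.pow 2) (pow_ne_zero 2 h))).add
    ((hasDerivAt_const κ (s * b')).div (h2.pow 2) (pow_ne_zero 2 h'))
  refine e.congr_deriv ?_
  simp only [scalarPoleDeriv]
  field_simp
  norm_num
  ring

lemma scalarPole_eq_inv (p s b b' κ : ℂ) :
    scalarPole p s b b' κ = b * (κ - p)⁻¹ - s * b * (κ + p)⁻¹ + b' * (κ - p)⁻¹ ^ 2
      + s * b' * (κ + p)⁻¹ ^ 2 := by
  simp only [scalarPole, div_eq_mul_inv, inv_pow]

lemma scalarPoleDeriv_eq_inv (p s b b' κ : ℂ) :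
    scalarPoleDeriv p s b b' κ = -b * (κ - p)⁻¹ ^ 2 + s * b * (κ + p)⁻¹ ^ 2
      - 2 * b' * (κ - p)⁻¹ ^ 3 - 2 * s * b' * (κ + p)⁻¹ ^ 3 := by
  simp only [scalarPoleDeriv, div_eq_mul_inv, inv_pow]

/-- The partial fractions of a product of two pole parts at distinct points: the residues at one
point involve the value and the derivative of the other factor there. -/
lemma scalarPole_mul_scalarPole (p q s s' b b' a a' κ : ℂ) (hs : s * s = 1) (hs' : s' * s' = 1)
    (h1 : κ - p ≠ 0) (h2 : κ + p ≠ 0) (h3 : κ - q ≠ 0) (h4 : κ + q ≠ 0)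
    (h5 : p - q ≠ 0) (h6 : p + q ≠ 0) :
    scalarPole p s b b' κ * scalarPole q s' a a' κ =
      scalarPole p (s * s') (b * scalarPole q s' a a' p + b' * scalarPoleDeriv q s' a a' p)
        (b' * scalarPole q s' a a' p) κ +
      scalarPole q (s * s') (scalarPole p s b b' q * a + scalarPoleDeriv p s b b' q * a')
        (scalarPole p s b b' q * a') κ := by
  have c1 : (q - p)⁻¹ = -(p - q)⁻¹ := by rw [← neg_sub, inv_neg]
  have c2 : q + p = p + q := add_comm _ _
  simp only [scalarPole_eq_inv, scalarPoleDeriv_eq_inv, c1, c2]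
  -- products of reciprocals with distinct poles
  have e1 : (κ - p)⁻¹ * (κ - q)⁻¹ = (p - q)⁻¹ * ((κ - p)⁻¹ - (κ - q)⁻¹) := by
    field_simp; ring
  have e2 : (κ - p)⁻¹ * (κ + q)⁻¹ = (p + q)⁻¹ * ((κ - p)⁻¹ - (κ + q)⁻¹) := by
    field_simp; ring
  have e3 : (κ + p)⁻¹ * (κ - q)⁻¹ = -(p + q)⁻¹ * ((κ + p)⁻¹ - (κ - q)⁻¹) := by
    field_simp; ring
  have e4 : (κ + p)⁻¹ * (κ + q)⁻¹ = -(p - q)⁻¹ * ((κ + p)⁻¹ - (κ + q)⁻¹) := by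
    field_simp; ring
  have key : ∀ u v c : ℂ, u * v = c * (u - v) →
      u ^ 2 * v = c * u ^ 2 - c ^ 2 * (u - v) ∧ u * v ^ 2 = c ^ 2 * (u - v) - c * v ^ 2 ∧
      u ^ 2 * v ^ 2 = c ^ 2 * (u ^ 2 + v ^ 2) - 2 * c ^ 3 * (u - v) := by
    intro u v c h
    refine ⟨by linear_combination (u - c) * h, by linear_combination (v + c) * h,
      by linear_combination (u * v + c * (u - v) - 2 * c ^ 2) * h⟩
  obtain ⟨f1, g1, k1⟩ := key _ _ _ e1
  obtain ⟨f2, g2, k2⟩ := key _ _ _ e2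
  obtain ⟨f3, g3, k3⟩ := key _ _ _ e3
  obtain ⟨f4, g4, k4⟩ := key _ _ _ e4
  generalize (κ - p)⁻¹ = u at *
  generalize (κ + p)⁻¹ = v at *
  generalize (κ - q)⁻¹ = U at *
  generalize (κ + q)⁻¹ = V at *
  generalize (p - q)⁻¹ = c at *
  generalize (p + q)⁻¹ = d at *
  have t1 : s = 1 ∨ s = -1 := mul_self_eq_one_iff.1 hs
  have t2 : s' = 1 ∨ s' = -1 := mul_self_eq_one_iff.1 hs'
  clear c1 c2 key hs hs'
  have main : (b * u - s * b * v + b' * u ^ 2 + s * b' * v ^ 2) *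
      (a * U - s' * a * V + a' * U ^ 2 + s' * a' * V ^ 2) =
      b * a * (c * (u - U)) - s' * b * a * (d * (u - V))
      + b * a' * (c ^ 2 * (u - U) - c * U ^ 2) + s' * b * a' * (d ^ 2 * (u - V) - d * V ^ 2)
      - s * b * a * (-d * (v - U)) + s * s' * b * a * (-c * (v - V))
      - s * b * a' * (d ^ 2 * (v - U) - -d * U ^ 2)
      - s * s' * b * a' * (c ^ 2 * (v - V) - -c * V ^ 2)
      + b' * a * (c * u ^ 2 - c ^ 2 * (u - U)) - s' * b' * a * (d * u ^ 2 - d ^ 2 * (u - V))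
      + b' * a' * (c ^ 2 * (u ^ 2 + U ^ 2) - 2 * c ^ 3 * (u - U))
      + s' * b' * a' * (d ^ 2 * (u ^ 2 + V ^ 2) - 2 * d ^ 3 * (u - V))
      + s * b' * a * (-d * v ^ 2 - d ^ 2 * (v - U))
      - s * s' * b' * a * (-c * v ^ 2 - c ^ 2 * (v - V))
      + s * b' * a' * (d ^ 2 * (v ^ 2 + U ^ 2) + 2 * d ^ 3 * (v - U))
      + s * s' * b' * a' * (c ^ 2 * (v ^ 2 + V ^ 2) + 2 * c ^ 3 * (v - V)) := by
    linear_combination b * a * e1 - s' * b * a * e2 + b * a' * g1 + s' * b * a' * g2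
      - s * b * a * e3 + s * s' * b * a * e4 - s * b * a' * g3 - s * s' * b * a' * g4
      + b' * a * f1 - s' * b' * a * f2 + b' * a' * k1 + s' * b' * a' * k2
      + s * b' * a * f3 - s * s' * b' * a * f4 + s * b' * a' * k3 + s * s' * b' * a' * k4
  rw [main]
  rcases t1 with rfl | rfl <;> rcases t2 with rfl | rfl <;> ring

/-- Off the diagonal, the residues of a product of two pole parts add up to zero: the product is of
second order at infinity, and there both residues at `±p` carry the same sign. -/
lemma scalarPole_residue_sum (p q s s' b b' a a' : ℂ) (hs : s * s = 1) (hss : s * s' = -1) :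
    b * scalarPole q s' a a' p + b' * scalarPoleDeriv q s' a a' p +
      (scalarPole p s b b' q * a + scalarPoleDeriv p s b b' q * a') = 0 := by
  have c1 : (q - p)⁻¹ = -(p - q)⁻¹ := by rw [← neg_sub, inv_neg]
  have c2 : q + p = p + q := add_comm _ _
  simp only [scalarPole_eq_inv, scalarPoleDeriv_eq_inv, c1, c2]
  have t1 : s = 1 ∨ s = -1 := mul_self_eq_one_iff.1 hs
  rcases t1 with rfl | rfl
  · obtain rfl : s' = -1 := by simpa using hss
    ring
  · obtain rfl : s' = 1 := by simpa using hss
    ring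

lemma polePart_mul_polePart (p q : ℂ) (B B' A A' : Mat) (κ : ℂ)
    (h1 : κ - p ≠ 0) (h2 : κ + p ≠ 0) (h3 : κ - q ≠ 0) (h4 : κ + q ≠ 0)
    (h5 : p - q ≠ 0) (h6 : p + q ≠ 0) :
    polePart p B B' κ * polePart q A A' κ =
      polePart p (B * polePart q A A' p + B' * polePartDeriv q A A' p)
        (B' * polePart q A A' p) κ +
      polePart q (polePart p B B' q * A + polePartDeriv p B B' q * A')
        (polePart p B B' q * A') κ := by
  have key : ∀ i l j, polePart p B B' κ i l * polePart q A A' κ l j = _ := fun i l j => by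
    rw [polePart_apply, polePart_apply, scalarPole_mul_scalarPole p q _ _ _ _ _ _ κ
      (by rw [mul_mul_mul_comm, sgn_mul_self, sgn_mul_self, one_mul])
      (by rw [mul_mul_mul_comm, sgn_mul_self, sgn_mul_self, one_mul]) h1 h2 h3 h4 h5 h6]
  have sg : ∀ i l j : Fin 2, sgn i * sgn l * (sgn l * sgn j) = sgn i * sgn j := fun i l j => by
    linear_combination sgn i * sgn j * sgn_mul_self l
  ext i j
  rw [Matrix.mul_apply, Finset.sum_congr rfl fun l _ => key i l j]
  simp only [sg, ← polePart_apply, ← polePartDeriv_apply, Matrix.add_apply]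
  simp only [polePart_apply p (_ + _), polePart_apply q (_ + _), Matrix.add_apply,
    Matrix.mul_apply, Fin.sum_univ_two]
  simp only [scalarPole]
  ring

lemma polePart_residue_sum (p q : ℂ) (B B' A A' : Mat) (i j : Fin 2) (hij : i ≠ j) :
    (B * polePart q A A' p + B' * polePartDeriv q A A' p) i j +
      (polePart p B B' q * A + polePartDeriv p B B' q * A') i j = 0 := by
  have hij' : sgn i * sgn j = -1 := by
    revert hij
    fin_cases i <;> fin_cases j <;> simp
  have key : ∀ l, B i l * polePart q A A' p l j + B' i l * polePartDeriv q A A' p l j +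
      (polePart p B B' q i l * A l j + polePartDeriv p B B' q i l * A' l j) = 0 := fun l => by
    simp only [polePart_apply, polePartDeriv_apply]
    refine scalarPole_residue_sum p q _ _ _ _ _ _ ?_ ?_
    · rw [mul_mul_mul_comm, sgn_mul_self, sgn_mul_self, one_mul]
    · linear_combination hij' + sgn i * sgn j * sgn_mul_self l
  have := key 0
  have := key 1
  simp only [Matrix.add_apply, Matrix.mul_apply, Fin.sum_univ_two]
  linear_combination key 0 + key 1

lemma conj_scalarPole (p s b b' κ : ℂ) (hs : conj s = s) :
    conj (scalarPole p s b b' κ) = scalarPole (conj p) s (conj b) (conj b') (conj κ) := by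
  simp [scalarPole, hs]

lemma polePart_conjTranspose (p : ℂ) (B B' : Mat) (κ : ℂ) :
    (polePart p B B' κ)ᴴ = polePart (conj p) Bᴴ B'ᴴ (conj κ) := by
  ext i j
  simp only [Matrix.conjTranspose_apply, polePart_apply]
  rw [← starRingEnd_apply, conj_scalarPole _ _ _ _ _ (by simp), mul_comm (sgn i)]
  rfl

lemma polePartDeriv_conjTranspose (p : ℂ) (B B' : Mat) (κ : ℂ) :
    (polePartDeriv p B B' κ)ᴴ = polePartDeriv (conj p) Bᴴ B'ᴴ (conj κ) := by
  ext i j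
  simp only [Matrix.conjTranspose_apply, polePartDeriv_apply, ← starRingEnd_apply]
  have h2 : conj (2 : ℂ) = 2 := map_ofNat _ 2
  simp [scalarPoleDeriv, mul_comm (sgn i), h2]

lemma polePart_neg (p : ℂ) (B B' : Mat) (κ : ℂ) :
    polePart p (-B) (-B') κ = -polePart p B B' κ := by
  ext i j
  simp only [polePart_apply, Matrix.neg_apply, scalarPole]
  ring

lemma polePart_add (p : ℂ) (B B' C C' : Mat) (κ : ℂ) :
    polePart p (B + C) (B' + C') κ = polePart p B B' κ + polePart p C C' κ := by
  ext i j
  simp only [polePart_apply, Matrix.add_apply, scalarPole]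
  ring

lemma polePart_parity (p : ℂ) (B B' : Mat) (κ : ℂ) :
    sigma3 * polePart p B B' (-κ) * sigma3 = polePart p B B' κ := by
  have e1 : (-κ - p)⁻¹ = -(κ + p)⁻¹ := by rw [← inv_neg]; ring_nf
  have e2 : (-κ + p)⁻¹ = -(κ - p)⁻¹ := by rw [← inv_neg]; ring_nf
  ext i j
  rw [sigma3_conj_apply]
  simp only [polePart_apply, scalarPole_eq_inv, e1, e2]
  fin_cases i <;> fin_cases j <;> simp <;> ring

/-! ### The linear system of one dressing step -/

/-- The pole part with the row space prescribed by the jet `y + (κ - p) w`: it is the polar part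
at `p` of `(z / (κ - p)² + z' / (κ - p)) (y + (κ - p) w)`, symmetrised. -/
def jetPole (p : ℂ) (y w z z' : Vec) (κ : ℂ) : Mat :=
  polePart p (Matrix.vecMulVec z w + Matrix.vecMulVec z' y) (Matrix.vecMulVec z y) κ

/-- The derivative of `jetPole` in the spectral parameter. -/
def jetPoleDeriv (p : ℂ) (y w z z' : Vec) (κ : ℂ) : Mat :=
  polePartDeriv p (Matrix.vecMulVec z w + Matrix.vecMulVec z' y) (Matrix.vecMulVec z y) κ

/-- One row of `jetPole` at `p̄`, applied to `y†`. -/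
def rowValue (p s : ℂ) (y w : Vec) (ζ ζ' : ℂ) : ℂ :=
  ∑ j, scalarPole p (s * sgn j) (ζ * w j + ζ' * y j) (ζ * y j) (conj p) * conj (y j)

/-- One row of the first-order term of `jetPole` at `p̄` applied to `y† + (κ - p̄) w†`. -/
def rowSlope (p s : ℂ) (y w : Vec) (ζ ζ' : ℂ) : ℂ :=
  ∑ j, (scalarPole p (s * sgn j) (ζ * w j + ζ' * y j) (ζ * y j) (conj p) * conj (w j)
    + scalarPoleDeriv p (s * sgn j) (ζ * w j + ζ' * y j) (ζ * y j) (conj p) * conj (y j))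

lemma jetPole_mulVec (p : ℂ) (y w z z' : Vec) (i : Fin 2) :
    (jetPole p y w z z' (conj p) *ᵥ star y) i = rowValue p (sgn i) y w (z i) (z' i) := by
  simp [jetPole, rowValue, Matrix.mulVec, dotProduct, polePart_apply, Matrix.vecMulVec_apply]

lemma jetPoleDeriv_mulVec (p : ℂ) (y w z z' : Vec) (i : Fin 2) :
    (jetPole p y w z z' (conj p) *ᵥ star w + jetPoleDeriv p y w z z' (conj p) *ᵥ star y) i
      = rowSlope p (sgn i) y w (z i) (z' i) := by
  simp only [jetPole, jetPoleDeriv, rowSlope, Matrix.mulVec, dotProduct, Pi.add_apply,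
    polePart_apply, polePartDeriv_apply, Matrix.add_apply, Matrix.vecMulVec_apply,
    Finset.sum_add_distrib]
  rfl

/-- The linear system is nondegenerate: the skew part of its sesquilinear form is the Gram form
of the kernel `1 / (κ - λ̄)`, which is definite on the jets `y + (κ - p) w` with `y ≠ 0`. -/
lemma row_injective (p s : ℂ) (y w : Vec) (ζ ζ' : ℂ) (hs : s = 1 ∨ s = -1) (hy : y ≠ 0)
    (hp : conj p - p ≠ 0) (h0 : rowValue p s y w ζ ζ' = 0) (h1 : rowSlope p s y w ζ ζ' = 0) :
    ζ = 0 ∧ ζ' = 0 := by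
  have hc : conj (conj p - p)⁻¹ = -(conj p - p)⁻¹ := by
    rw [map_inv₀, ← inv_neg]; simp
  have hd : conj (conj p + p)⁻¹ = (conj p + p)⁻¹ := by
    rw [map_inv₀]; simp [add_comm]
  have hc0 : (conj p - p)⁻¹ ≠ 0 := inv_ne_zero hp
  have hs' : conj s = s := by rcases hs with rfl | rfl <;> simp
  have h2 : conj (2 : ℂ) = 2 := map_ofNat _ 2
  have H0 : conj ζ' * rowValue p s y w ζ ζ' + conj ζ * rowSlope p s y w ζ ζ' = 0 := by
    rw [h0, h1]; ring
  have H1 := congrArg conj H0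
  simp only [rowValue, rowSlope, scalarPole_eq_inv, scalarPoleDeriv_eq_inv, Fin.sum_univ_two,
    map_add, map_sub, map_mul, map_neg, map_pow, hc, hd, hs', h2, conj_sgn, map_zero,
    Complex.conj_conj] at H0 H1
  generalize (conj p - p)⁻¹ = c at *
  generalize (conj p + p)⁻¹ = d at *
  -- in the skew part the terms with `d = (p̄ + p)⁻¹` cancel, and the rest is a sum of squares
  have key : ∑ j, (((ζ * w j + ζ' * y j) + c * (ζ * y j))
        * conj ((ζ * w j + ζ' * y j) + c * (ζ * y j)) + c * (ζ * y j) * conj (c * (ζ * y j)))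
        = 0 := by
    have h3 : 2 * c ≠ 0 := by simpa using hc0
    apply mul_left_cancel₀ h3
    simp only [Fin.sum_univ_two, map_add, map_mul, hc]
    linear_combination H0 - H1
  simp only [Complex.mul_conj, Fin.sum_univ_two] at key
  norm_cast at key
  have n := fun z => Complex.normSq_nonneg z
  have z0 : c * (ζ * y 0) = 0 := Complex.normSq_eq_zero.1 (by
    nlinarith [n (c * (ζ * y 0)), n (c * (ζ * y 1)), n (ζ * w 0 + ζ' * y 0 + c * (ζ * y 0)),
      n (ζ * w 1 + ζ' * y 1 + c * (ζ * y 1))])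
  have z1 : c * (ζ * y 1) = 0 := Complex.normSq_eq_zero.1 (by
    nlinarith [n (c * (ζ * y 0)), n (c * (ζ * y 1)), n (ζ * w 0 + ζ' * y 0 + c * (ζ * y 0)),
      n (ζ * w 1 + ζ' * y 1 + c * (ζ * y 1))])
  have x0 : ζ * w 0 + ζ' * y 0 + c * (ζ * y 0) = 0 := Complex.normSq_eq_zero.1 (by
    nlinarith [n (c * (ζ * y 0)), n (c * (ζ * y 1)), n (ζ * w 0 + ζ' * y 0 + c * (ζ * y 0)),
      n (ζ * w 1 + ζ' * y 1 + c * (ζ * y 1))])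
  have x1 : ζ * w 1 + ζ' * y 1 + c * (ζ * y 1) = 0 := Complex.normSq_eq_zero.1 (by
    nlinarith [n (c * (ζ * y 0)), n (c * (ζ * y 1)), n (ζ * w 0 + ζ' * y 0 + c * (ζ * y 0)),
      n (ζ * w 1 + ζ' * y 1 + c * (ζ * y 1))])
  have hy' : y 0 ≠ 0 ∨ y 1 ≠ 0 := by
    by_contra! h
    exact hy (by ext i; fin_cases i <;> simp [h.1, h.2])
  have hζ : ζ = 0 := by
    rcases hy' with h | h
    · simpa [hc0, h] using z0
    · simpa [hc0, h] using z1
  subst hζ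
  refine ⟨rfl, ?_⟩
  rcases hy' with h | h
  · simpa [h] using x0
  · simpa [h] using x1

section system

variable (p s : ℂ) (y w : Vec)

lemma pairing_eq (s : ℂ) (u v : Vec) :
    pairing s u v = (1 + s) * (u 0 * conj (v 0)) + (1 - s) * (u 1 * conj (v 1)) := by
  simp [pairing, sigma3, Matrix.mulVec, dotProduct, Fin.sum_univ_two, Matrix.one_apply]
  ring

lemma sub_ne_zero_of_gap (p : ℂ) (h : gap p ≠ 0) : conj p - p ≠ 0 ∧ conj p + p ≠ 0 := by
  have e : gap p = -(conj p - p) * (conj p + p) := by simp only [gap]; ring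
  rw [e] at h
  exact ⟨fun h' => h (by rw [h']; ring), fun h' => h (by rw [h']; ring)⟩

/-- The rows of the linear system in terms of the scalars `a`, `b`, `c`. -/
lemma rowValue_eq (hs : s = 1 ∨ s = -1) (hg : gap p ≠ 0) (ζ ζ' : ℂ) :
    rowValue p s y w ζ ζ' =
      ζ * (bCoef p s y y - gap p * aCoef p s w y) / gap p ^ 2
        - ζ' * aCoef p s y y / gap p := by
  obtain ⟨h1, h2⟩ := sub_ne_zero_of_gap p hg
  simp only [rowValue, aCoef, bCoef, pairing_eq, scalarPole, Fin.sum_univ_two, gap, sgn_zero,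
    sgn_one]
  clear hg
  -- in terms of `X = p̄ - p` and `Z = p̄ + p` all denominators are monomials
  generalize conj p = r at *
  obtain ⟨X, hX⟩ : ∃ X, X = r - p := ⟨_, rfl⟩
  obtain ⟨Z, hZ⟩ : ∃ Z, Z = r + p := ⟨_, rfl⟩
  have e : p ^ 2 - r ^ 2 = -(X * Z) := by rw [hX, hZ]; ring
  rw [e, ← hX, ← hZ]
  rw [← hX] at h1
  rw [← hZ] at h2
  obtain rfl : p = (Z - X) / 2 := by rw [hX, hZ]; ring
  obtain rfl : r = (Z + X) / 2 := by linear_combination -hX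
  clear hX hZ e
  rcases hs with rfl | rfl <;> field_simp <;> ring

lemma rowSlope_eq (hs : s = 1 ∨ s = -1) (hg : gap p ≠ 0) (ζ ζ' : ℂ) :
    rowSlope p s y w ζ ζ' =
      ζ * (-(gap p ^ 2) * aCoef p s w w + gap p * (bCoef p s y w - bCoef p (-s) w y)
        + 2 * cCoef p (-s) y y) / gap p ^ 3
        - ζ' * (gap p * aCoef p s y w + bCoef p (-s) y y) / gap p ^ 2 := by
  obtain ⟨h1, h2⟩ := sub_ne_zero_of_gap p hg
  simp only [rowSlope, aCoef, bCoef, cCoef, pairing_eq, scalarPole, scalarPoleDeriv,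
    Fin.sum_univ_two, gap, sgn_zero, sgn_one]
  clear hg
  -- in terms of `X = p̄ - p` and `Z = p̄ + p` all denominators are monomials
  generalize conj p = r at *
  obtain ⟨X, hX⟩ : ∃ X, X = r - p := ⟨_, rfl⟩
  obtain ⟨Z, hZ⟩ : ∃ Z, Z = r + p := ⟨_, rfl⟩
  have e : p ^ 2 - r ^ 2 = -(X * Z) := by rw [hX, hZ]; ring
  rw [e, ← hX, ← hZ]
  rw [← hX] at h1
  rw [← hZ] at h2
  obtain rfl : p = (Z - X) / 2 := by rw [hX, hZ]; ring
  obtain rfl : r = (Z + X) / 2 := by linear_combination -hX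
  clear hX hZ e
  rcases hs with rfl | rfl <;> field_simp <;> ring

lemma delta_ne_zero (hs : s = 1 ∨ s = -1) (hg : gap p ≠ 0) (hy : y ≠ 0) :
    delta p s y w ≠ 0 := by
  intro hΔ
  have hp := (sub_ne_zero_of_gap p hg).1
  have inj := fun ζ ζ' => row_injective p s y w ζ ζ' hs hy hp
  simp only [rowValue_eq p s y w hs hg, rowSlope_eq p s y w hs hg] at inj
  rw [delta] at hΔ
  -- the columns of the adjugate of a singular matrix are kernel vectors
  have k1 := inj (gap p * aCoef p s y y) (bCoef p s y y - gap p * aCoef p s w y)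
    (by field_simp; ring) (by field_simp; linear_combination hΔ)
  have k2 := inj (gap p * (gap p * aCoef p s y w + bCoef p (-s) y y))
    (-(gap p ^ 2) * aCoef p s w w + gap p * (bCoef p s y w - bCoef p (-s) w y)
        + 2 * cCoef p (-s) y y)
    (by field_simp; linear_combination -hΔ) (by field_simp; ring)
  have ha : aCoef p s y y = 0 := by simpa [hg] using k1.1
  have hb : gap p * aCoef p s y w + bCoef p (-s) y y = 0 := by simpa [hg] using k2.1
  exact one_ne_zero (inj 0 1 (by rw [ha]; ring) (by rw [hb]; ring)).2

end system

lemma star_vec_apply (v : Vec) (i : Fin 2) : star v i = conj (v i) := rfl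

lemma zVec_apply (p : ℂ) (y w : Vec) (i : Fin 2) :
    zVec p y w i = lambdaEntry p (sgn i) y w * conj (w i)
      + omegaEntry p (sgn i) y w * conj (y i) := by
  fin_cases i <;> simp [zVec, signDiag]

lemma zTildeVec_apply (p : ℂ) (y w : Vec) (i : Fin 2) :
    zTildeVec p y w i = lambdaTildeEntry p (sgn i) y w * conj (w i)
      + omegaTildeEntry p (sgn i) y w * conj (y i) := by
  fin_cases i <;> simp [zTildeVec, signDiag]

lemma sgn_eq (i : Fin 2) : sgn i = 1 ∨ sgn i = -1 := by
  fin_cases i <;> simp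

lemma jetPole_injective (p : ℂ) (y w z z' : Vec) (hy : y ≠ 0) (hg : gap p ≠ 0)
    (h0 : jetPole p y w z z' (conj p) *ᵥ star y = 0)
    (h1 : jetPole p y w z z' (conj p) *ᵥ star w + jetPoleDeriv p y w z z' (conj p) *ᵥ star y = 0) :
    z = 0 ∧ z' = 0 := by
  have h : ∀ i, z i = 0 ∧ z' i = 0 := fun i =>
    row_injective p (sgn i) y w _ _ (sgn_eq i) hy (sub_ne_zero_of_gap p hg).1
      (by rw [← jetPole_mulVec, h0]; rfl) (by rw [← jetPoleDeriv_mulVec, h1]; rfl)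
  exact ⟨funext fun i => (h i).1, funext fun i => (h i).2⟩

/-- The vectors `z` and `z̃` solve the linear system saying that the dressing factor annihilates
the jet `y† + (κ - p̄) w†` at `p̄` to first order. -/
lemma jetPole_zVec (p : ℂ) (y w : Vec) (hy : y ≠ 0) (hg : gap p ≠ 0) :
    jetPole p y w (zVec p y w) (zTildeVec p y w) (conj p) *ᵥ star y = -star y ∧
    jetPole p y w (zVec p y w) (zTildeVec p y w) (conj p) *ᵥ star w
      + jetPoleDeriv p y w (zVec p y w) (zTildeVec p y w) (conj p) *ᵥ star y = -star w := by
  constructor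
  · ext i
    have hΔ := delta_ne_zero p (sgn i) y w (sgn_eq i) hg hy
    rw [jetPole_mulVec, rowValue_eq _ _ _ _ (sgn_eq i) hg, zVec_apply, zTildeVec_apply,
      lambdaEntry, omegaEntry, lambdaTildeEntry, omegaTildeEntry]
    simp only [Pi.neg_apply, star_vec_apply]
    generalize hd : delta p (sgn i) y w = Δ at *
    rw [delta] at hd
    field_simp
    linear_combination -(conj (y i)) * hd
  · ext i
    have hΔ := delta_ne_zero p (sgn i) y w (sgn_eq i) hg hy
    rw [jetPoleDeriv_mulVec, rowSlope_eq _ _ _ _ (sgn_eq i) hg, zVec_apply, zTildeVec_apply,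
      lambdaEntry, omegaEntry, lambdaTildeEntry, omegaTildeEntry]
    simp only [Pi.neg_apply, star_vec_apply]
    generalize hd : delta p (sgn i) y w = Δ at *
    rw [delta] at hd
    field_simp
    linear_combination -(gap p * conj (w i)) * hd

/-! ### The inverse of a dressing factor -/

lemma bMat_conjTranspose (p : ℂ) (y w : Vec) :
    (bMat p y w)ᴴ = Matrix.vecMulVec (star w) (star (zVec p y w))
      + Matrix.vecMulVec (star y) (star (zTildeVec p y w)) := by
  simp [bMat, Matrix.conjTranspose_vecMulVec]

lemma bTildeMat_conjTranspose (p : ℂ) (y w : Vec) :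
    (bTildeMat p y w)ᴴ = Matrix.vecMulVec (star y) (star (zVec p y w)) := by
  simp [bTildeMat, Matrix.conjTranspose_vecMulVec]

/-- The residues at `p̄` of the product of the two pole parts. -/
lemma bMat_residue (p : ℂ) (y w : Vec) (hy : y ≠ 0) (hg : gap p ≠ 0) :
    polePart p (bMat p y w) (bTildeMat p y w) (conj p) * (bMat p y w)ᴴ
        + polePartDeriv p (bMat p y w) (bTildeMat p y w) (conj p) * (bTildeMat p y w)ᴴ
      = -(bMat p y w)ᴴ ∧
    polePart p (bMat p y w) (bTildeMat p y w) (conj p) * (bTildeMat p y w)ᴴ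
      = -(bTildeMat p y w)ᴴ := by
  obtain ⟨h0, h1⟩ := jetPole_zVec p y w hy hg
  change polePart p (bMat p y w) (bTildeMat p y w) (conj p) *ᵥ star y = _ at h0
  change polePart p (bMat p y w) (bTildeMat p y w) (conj p) *ᵥ star w +
    polePartDeriv p (bMat p y w) (bTildeMat p y w) (conj p) *ᵥ star y = _ at h1
  rw [bMat_conjTranspose, bTildeMat_conjTranspose, Matrix.mul_add]
  simp only [Matrix.mul_vecMulVec]
  rw [h0]
  constructor
  · rw [add_right_comm, ← Matrix.add_vecMulVec, h1]
    simp only [Matrix.neg_vecMulVec, neg_add]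
  · simp only [Matrix.neg_vecMulVec]

lemma bMat_residue' (p : ℂ) (y w : Vec) (hy : y ≠ 0) (hg : gap p ≠ 0) :
    bMat p y w * polePart (conj p) (bMat p y w)ᴴ (bTildeMat p y w)ᴴ p
        + bTildeMat p y w * polePartDeriv (conj p) (bMat p y w)ᴴ (bTildeMat p y w)ᴴ p
      = -bMat p y w ∧
    bTildeMat p y w * polePart (conj p) (bMat p y w)ᴴ (bTildeMat p y w)ᴴ p
      = -bTildeMat p y w := by
  obtain ⟨h1, h2⟩ := bMat_residue p y w hy hg
  constructor
  · have := congrArg Matrix.conjTranspose h1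
    simpa [polePart_conjTranspose, polePartDeriv_conjTranspose] using this
  · have := congrArg Matrix.conjTranspose h2
    simpa [polePart_conjTranspose] using this

lemma dressing_mul_inverse (p : ℂ) (y w : Vec) (κ : ℂ) (hy : y ≠ 0) (hg : gap p ≠ 0)
    (h1 : κ - p ≠ 0) (h2 : κ + p ≠ 0) (h3 : κ - conj p ≠ 0) (h4 : κ + conj p ≠ 0) :
    (1 + polePart p (bMat p y w) (bTildeMat p y w) κ) *
      (1 + polePart (conj p) (bMat p y w)ᴴ (bTildeMat p y w)ᴴ κ) = 1 := by
  obtain ⟨h5, h6⟩ := sub_ne_zero_of_gap p hg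
  have h5' : p - conj p ≠ 0 := by rw [← neg_sub]; exact neg_ne_zero.2 h5
  have h6' : p + conj p ≠ 0 := by rwa [add_comm]
  rw [Matrix.mul_add, Matrix.mul_one, Matrix.add_mul, Matrix.one_mul,
    polePart_mul_polePart p (conj p) _ _ _ _ κ h1 h2 h3 h4 h5' h6',
    (bMat_residue p y w hy hg).1, (bMat_residue p y w hy hg).2,
    (bMat_residue' p y w hy hg).1, (bMat_residue' p y w hy hg).2, polePart_neg, polePart_neg]
  simp

/-- The off-diagonal part of `B` is skew-Hermitian: this is the first-order term of the unitarity
of the dressing factor at infinity. -/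
lemma bMat_one_zero (p : ℂ) (y w : Vec) (hy : y ≠ 0) (hg : gap p ≠ 0) :
    bMat p y w 1 0 = -conj (bMat p y w 0 1) := by
  have h := polePart_residue_sum p (conj p) (bMat p y w) (bTildeMat p y w) (bMat p y w)ᴴ
    (bTildeMat p y w)ᴴ 1 0 (by simp)
  rw [(bMat_residue p y w hy hg).1, (bMat_residue' p y w hy hg).1] at h
  simp only [Matrix.neg_apply, Matrix.conjTranspose_apply, ← starRingEnd_apply] at h
  linear_combination -h

/-! ### Entrywise derivatives -/

/-- `F'` is the entrywise derivative at `x` of a matrix function of a real or complex variable. -/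
def HasMatDeriv {𝕜 : Type*} [NontriviallyNormedField 𝕜] [NormedAlgebra 𝕜 ℂ]
    (F : 𝕜 → Mat) (F' : Mat) (x : 𝕜) : Prop :=
  ∀ i j, HasDerivAt (fun x => F x i j) (F' i j) x

/-- `v'` is the entrywise derivative at `x` of a vector function. -/
def HasVecDeriv {𝕜 : Type*} [NontriviallyNormedField 𝕜] [NormedAlgebra 𝕜 ℂ]
    (v : 𝕜 → Vec) (v' : Vec) (x : 𝕜) : Prop :=
  ∀ i, HasDerivAt (fun x => v x i) (v' i) x

section deriv

variable {𝕜 : Type*} [NontriviallyNormedField 𝕜] [NormedAlgebra 𝕜 ℂ] {F G : 𝕜 → Mat}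
  {F' G' : Mat} {u v : 𝕜 → Vec} {u' v' : Vec} {x : 𝕜}

lemma HasMatDeriv.unique (h : HasMatDeriv F F' x) (h' : HasMatDeriv F G' x) : F' = G' := by
  ext i j
  exact (h i j).unique (h' i j)

lemma HasVecDeriv.unique (h : HasVecDeriv v v' x) (h' : HasVecDeriv v u' x) : v' = u' := by
  ext i
  exact (h i).unique (h' i)

lemma hasMatDeriv_const (A : Mat) (x : 𝕜) : HasMatDeriv (fun _ => A) 0 x :=
  fun _ _ => hasDerivAt_const _ _

lemma hasVecDeriv_const (a : Vec) (x : 𝕜) : HasVecDeriv (fun _ => a) 0 x :=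
  fun _ => hasDerivAt_const _ _

lemma HasMatDeriv.add (h : HasMatDeriv F F' x) (h' : HasMatDeriv G G' x) :
    HasMatDeriv (fun x => F x + G x) (F' + G') x :=
  fun i j => (h i j).add (h' i j)

lemma HasMatDeriv.sub (h : HasMatDeriv F F' x) (h' : HasMatDeriv G G' x) :
    HasMatDeriv (fun x => F x - G x) (F' - G') x :=
  fun i j => (h i j).sub (h' i j)

lemma HasVecDeriv.add (h : HasVecDeriv u u' x) (h' : HasVecDeriv v v' x) :
    HasVecDeriv (fun x => u x + v x) (u' + v') x :=
  fun i => (h i).add (h' i)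

lemma HasMatDeriv.mul (h : HasMatDeriv F F' x) (h' : HasMatDeriv G G' x) :
    HasMatDeriv (fun x => F x * G x) (F' * G x + F x * G') x := by
  intro i j
  simp only [Matrix.mul_apply, Fin.sum_univ_two, Matrix.add_apply]
  refine (((h i 0).mul (h' 0 j)).add ((h i 1).mul (h' 1 j))).congr_deriv ?_
  ring

lemma HasMatDeriv.mulVec (h : HasMatDeriv F F' x) (h' : HasVecDeriv v v' x) :
    HasVecDeriv (fun x => F x *ᵥ v x) (F' *ᵥ v x + F x *ᵥ v') x := by
  intro i
  simp only [Matrix.mulVec, dotProduct, Fin.sum_univ_two, Pi.add_apply]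
  refine (((h i 0).mul (h' 0)).add ((h i 1).mul (h' 1))).congr_deriv ?_
  ring

lemma HasVecDeriv.vecMulVec (h : HasVecDeriv u u' x) (h' : HasVecDeriv v v' x) :
    HasMatDeriv (fun x => Matrix.vecMulVec (u x) (v x))
      (Matrix.vecMulVec u' (v x) + Matrix.vecMulVec (u x) v') x := by
  intro i j
  simp only [Matrix.vecMulVec_apply, Matrix.add_apply]
  exact (h i).mul (h' j)

lemma HasVecDeriv.star {v : ℝ → Vec} {x : ℝ} (h : HasVecDeriv v v' x) :
    HasVecDeriv (fun x => star (v x)) (star v') x :=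
  fun i => (h i).star

/-- With the spectral parameter fixed, a pole part is linear in its residues. -/
lemma HasMatDeriv.polePart (h : HasMatDeriv F F' x) (h' : HasMatDeriv G G' x) (p κ : ℂ) :
    HasMatDeriv (fun x => polePart p (F x) (G x) κ) (polePart p F' G' κ) x := by
  intro i j
  simp only [polePart_apply, scalarPole]
  exact ((((h i j).div_const _).sub (((h i j).const_mul _).div_const _)).add
    ((h' i j).div_const _)).add (((h' i j).const_mul _).div_const _)

lemma HasMatDeriv.polePartDeriv (h : HasMatDeriv F F' x) (h' : HasMatDeriv G G' x) (p κ : ℂ) :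
    HasMatDeriv (fun x => polePartDeriv p (F x) (G x) κ) (polePartDeriv p F' G' κ) x := by
  intro i j
  simp only [polePartDeriv_apply, scalarPoleDeriv]
  exact (((((h i j).neg).div_const _).add (((h i j).const_mul _).div_const _)).sub
    (((h' i j).const_mul _).div_const _)).sub (((h' i j).const_mul _).div_const _)

end deriv

lemma hasMatDeriv_polePart (p : ℂ) (B B' : Mat) (κ : ℂ) (h : κ - p ≠ 0) (h' : κ + p ≠ 0) :
    HasMatDeriv (polePart p B B') (polePartDeriv p B B' κ) κ := by
  intro i j
  simp only [polePart_apply]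
  exact hasDerivAt_scalarPole _ _ _ _ _ h h'

/-! ### Polynomials in the spectral parameter -/

/-- The matrix polynomial of degree at most four with the given coefficients. -/
def laxPoly (l : ℕ → Mat) (κ : ℂ) : Mat := ∑ n ∈ Finset.range 5, κ ^ n • l n

/-- The derivative of `laxPoly`. -/
def laxPolyDeriv (l : ℕ → Mat) (κ : ℂ) : Mat :=
  ∑ n ∈ Finset.range 5, ((n : ℂ) * κ ^ (n - 1)) • l n

/-- The coefficients of even degree are diagonal, those of odd degree are off-diagonal. -/
def HasParity (l : ℕ → Mat) : Prop := ∀ n, sigma3 * l n * sigma3 = (-1 : ℂ) ^ n • l n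

lemma hasMatDeriv_laxPoly (l : ℕ → Mat) (κ : ℂ) :
    HasMatDeriv (laxPoly l) (laxPolyDeriv l κ) κ := by
  intro i j
  simp only [laxPoly, laxPolyDeriv, Matrix.sum_apply, Matrix.smul_apply, smul_eq_mul]
  exact HasDerivAt.fun_sum fun n _ => (hasDerivAt_pow n κ).mul_const _

lemma laxPoly_conjTranspose (l : ℕ → Mat) (hl : ∀ n, (l n)ᴴ = -l n) (κ : ℂ) :
    (laxPoly l κ)ᴴ = -laxPoly l (conj κ) := by
  simp [laxPoly, Matrix.conjTranspose_sum, hl]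

lemma laxPolyDeriv_conjTranspose (l : ℕ → Mat) (hl : ∀ n, (l n)ᴴ = -l n) (κ : ℂ) :
    (laxPolyDeriv l κ)ᴴ = -laxPolyDeriv l (conj κ) := by
  simp [laxPolyDeriv, Matrix.conjTranspose_sum, hl]

/-- The coefficient of `κ ^ (-(n + 1))` in the expansion of `polePart p B B' κ` at infinity. -/
def infCoef (p : ℂ) (B B' : Mat) (n : ℕ) : Mat :=
  Matrix.of fun i j => (1 + (-1) ^ (n + 1) * (sgn i * sgn j)) *
    (p ^ n * B i j + n * p ^ (n - 1) * B' i j)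

lemma mul_scalarPole (p s b b' κ : ℂ) (h1 : κ - p ≠ 0) (h2 : κ + p ≠ 0) :
    κ * scalarPole p s b b' κ = (1 - s) * b + scalarPole p (-s) (p * b + b') (p * b') κ := by
  simp only [scalarPole]
  field_simp
  ring

/-- Multiplication of a pole part by `κ ^ n`: the coefficients at infinity up to order `n` become the
polynomial part, and the residues become those of the jet of `κ ^ n` times the old ones. -/
lemma pow_mul_scalarPole (p s b b' κ : ℂ) (h1 : κ - p ≠ 0) (h2 : κ + p ≠ 0) (n : ℕ) :
    κ ^ n * scalarPole p s b b' κ =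
      ∑ m ∈ Finset.range n, κ ^ (n - 1 - m) *
        ((1 + (-1) ^ (m + 1) * s) * (p ^ m * b + m * p ^ (m - 1) * b'))
      + scalarPole p ((-1) ^ n * s) (p ^ n * b + n * p ^ (n - 1) * b') (p ^ n * b') κ := by
  induction n with
  | zero => simp
  | succ n ih =>
    rw [pow_succ', mul_assoc, ih, mul_add, mul_scalarPole _ _ _ _ _ h1 h2,
      Finset.sum_range_succ, Finset.mul_sum, ← add_assoc]
    congr 1
    · congr 1
      · refine Finset.sum_congr rfl fun m hm => ?_
        have : n + 1 - 1 - m = (n - 1 - m) + 1 := by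
          have := Finset.mem_range.1 hm
          omega
        rw [this]
        ring
      · simp only [Nat.add_sub_cancel, Nat.sub_self, pow_zero, one_mul]
        ring
    · congr 1
      · ring
      · rcases n with _ | n
        · simp
        · simp only [Nat.add_sub_cancel]
          push_cast
          ring
      · ring

lemma parity_apply {n : ℕ} {l : Mat} (hl : sigma3 * l * sigma3 = (-1 : ℂ) ^ n • l) (i j : Fin 2) :
    l i j = 0 ∨ sgn i * sgn j = (-1) ^ n := by
  have h := congrFun (congrFun hl i) j
  rw [sigma3_conj_apply, Matrix.smul_apply, smul_eq_mul] at h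
  by_cases h0 : l i j = 0
  · exact Or.inl h0
  · exact Or.inr (mul_right_cancel₀ h0 h)

lemma polePart_mul_pow (p : ℂ) (B B' : Mat) (κ : ℂ) (h1 : κ - p ≠ 0) (h2 : κ + p ≠ 0) (n : ℕ)
    (l : Mat) (hl : sigma3 * l * sigma3 = (-1 : ℂ) ^ n • l) :
    polePart p B B' κ * (κ ^ n • l) =
      ∑ m ∈ Finset.range n, κ ^ (n - 1 - m) • (infCoef p B B' m * l)
      + polePart p (B * (p ^ n • l) + B' * (((n : ℂ) * p ^ (n - 1)) • l)) (B' * (p ^ n • l)) κ := by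
  have key : ∀ i r j, polePart p B B' κ i r * (κ ^ n * l r j) =
      ∑ m ∈ Finset.range n, κ ^ (n - 1 - m) * (infCoef p B B' m i r * l r j)
      + scalarPole p (sgn i * sgn j) (B i r * (p ^ n * l r j) + B' i r * (n * p ^ (n - 1) * l r j))
        (B' i r * (p ^ n * l r j)) κ := by
    intro i r j
    rcases parity_apply hl r j with h | h
    · simp [h, scalarPole]
    · have hs : sgn i * sgn j = (-1) ^ n * (sgn i * sgn r) := by
        linear_combination (-(sgn i * sgn j)) * sgn_mul_self r + sgn i * sgn r * h
      have := congrArg (· * l r j) (pow_mul_scalarPole p (sgn i * sgn r) (B i r) (B' i r) κ h1 h2 n)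
      simp only [add_mul, Finset.sum_mul, ← hs] at this
      rw [polePart_apply]
      calc _ = κ ^ n * scalarPole p (sgn i * sgn r) (B i r) (B' i r) κ * l r j := by ring
        _ = _ := by
          rw [this]
          congr 1
          · refine Finset.sum_congr rfl fun m _ => ?_
            simp only [infCoef, Matrix.of_apply]
            ring
          · simp only [scalarPole]
            ring
  ext i j
  rw [Matrix.mul_apply]
  simp only [Matrix.smul_apply, smul_eq_mul, key]
  simp only [Matrix.mul_apply, Matrix.smul_apply, smul_eq_mul, Matrix.add_apply, Matrix.sum_apply,
    polePart_apply, Fin.sum_univ_two, mul_add, Finset.sum_add_distrib, scalarPole]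
  ring

lemma pow_mul_polePart (p : ℂ) (B B' : Mat) (κ : ℂ) (h1 : κ - p ≠ 0) (h2 : κ + p ≠ 0) (n : ℕ)
    (l : Mat) (hl : sigma3 * l * sigma3 = (-1 : ℂ) ^ n • l) :
    (κ ^ n • l) * polePart p B B' κ =
      ∑ m ∈ Finset.range n, κ ^ (n - 1 - m) • (l * infCoef p B B' m)
      + polePart p ((p ^ n • l) * B + (((n : ℂ) * p ^ (n - 1)) • l) * B') ((p ^ n • l) * B') κ := by
  have key : ∀ i r j, κ ^ n * l i r * polePart p B B' κ r j =
      ∑ m ∈ Finset.range n, κ ^ (n - 1 - m) * (l i r * infCoef p B B' m r j)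
      + scalarPole p (sgn i * sgn j) (p ^ n * l i r * B r j + n * p ^ (n - 1) * l i r * B' r j)
        (p ^ n * l i r * B' r j) κ := by
    intro i r j
    rcases parity_apply hl i r with h | h
    · simp [h, scalarPole]
    · have hs : sgn i * sgn j = (-1) ^ n * (sgn r * sgn j) := by
        linear_combination (-(sgn i * sgn j)) * sgn_mul_self r + sgn r * sgn j * h
      have := congrArg (l i r * ·) (pow_mul_scalarPole p (sgn r * sgn j) (B r j) (B' r j) κ h1 h2 n)
      simp only [mul_add, Finset.mul_sum, ← hs] at this
      rw [polePart_apply]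
      calc _ = l i r * (κ ^ n * scalarPole p (sgn r * sgn j) (B r j) (B' r j) κ) := by ring
        _ = _ := by
          rw [this]
          congr 1
          · refine Finset.sum_congr rfl fun m _ => ?_
            simp only [infCoef, Matrix.of_apply]
            ring
          · simp only [scalarPole]
            ring
  ext i j
  rw [Matrix.mul_apply]
  simp only [Matrix.smul_apply, smul_eq_mul, key]
  simp only [Matrix.mul_apply, Matrix.smul_apply, smul_eq_mul, Matrix.add_apply, Matrix.sum_apply,
    polePart_apply, Fin.sum_univ_two, mul_add, Finset.sum_add_distrib, scalarPole]
  ring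

lemma polePart_zero (p κ : ℂ) : polePart p 0 0 κ = 0 := by simp [polePart]

lemma polePart_sum {ι : Type*} (s : Finset ι) (p : ℂ) (f g : ι → Mat) (κ : ℂ) :
    ∑ n ∈ s, polePart p (f n) (g n) κ = polePart p (∑ n ∈ s, f n) (∑ n ∈ s, g n) κ := by
  classical
  induction s using Finset.induction_on with
  | empty => simp [polePart_zero]
  | insert a s ha ih => simp only [Finset.sum_insert ha, ih, polePart_add]

lemma polePart_mul_laxPoly (p : ℂ) (B B' : Mat) (κ : ℂ) (h1 : κ - p ≠ 0) (h2 : κ + p ≠ 0)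
    (l : ℕ → Mat) (hl : HasParity l) :
    polePart p B B' κ * laxPoly l κ =
      ∑ n ∈ Finset.range 5, ∑ m ∈ Finset.range n, κ ^ (n - 1 - m) • (infCoef p B B' m * l n)
      + polePart p (B * laxPoly l p + B' * laxPolyDeriv l p) (B' * laxPoly l p) κ := by
  simp only [laxPoly, laxPolyDeriv, Finset.mul_sum, polePart_mul_pow p B B' κ h1 h2 _ _ (hl _),
    Finset.sum_add_distrib, polePart_sum]

lemma laxPoly_mul_polePart (p : ℂ) (B B' : Mat) (κ : ℂ) (h1 : κ - p ≠ 0) (h2 : κ + p ≠ 0)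
    (l : ℕ → Mat) (hl : HasParity l) :
    laxPoly l κ * polePart p B B' κ =
      ∑ n ∈ Finset.range 5, ∑ m ∈ Finset.range n, κ ^ (n - 1 - m) • (l n * infCoef p B B' m)
      + polePart p (laxPoly l p * B + laxPolyDeriv l p * B') (laxPoly l p * B') κ := by
  simp only [laxPoly, laxPolyDeriv, Finset.sum_mul, pow_mul_polePart p B B' κ h1 h2 _ _ (hl _),
    Finset.sum_add_distrib, polePart_sum]

/-- The positive powers of `κ` agree in `(1 + polePart p B B') L` and `M (1 + polePart p B B')`. -/
structure Matching (p : ℂ) (B B' : Mat) (l m : ℕ → Mat) : Prop where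
  four : l 4 = m 4
  three : l 3 + infCoef p B B' 0 * l 4 = m 3 + m 4 * infCoef p B B' 0
  two : l 2 + infCoef p B B' 0 * l 3 + infCoef p B B' 1 * l 4
    = m 2 + m 3 * infCoef p B B' 0 + m 4 * infCoef p B B' 1
  one : l 1 + infCoef p B B' 0 * l 2 + infCoef p B B' 1 * l 3 + infCoef p B B' 2 * l 4
    = m 1 + m 2 * infCoef p B B' 0 + m 3 * infCoef p B B' 1 + m 4 * infCoef p B B' 2
  zero : l 0 + infCoef p B B' 0 * l 1 + infCoef p B B' 1 * l 2 + infCoef p B B' 2 * l 3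
      + infCoef p B B' 3 * l 4
    = m 0 + m 1 * infCoef p B B' 0 + m 2 * infCoef p B B' 1 + m 3 * infCoef p B B' 2
      + m 4 * infCoef p B B' 3

/-- If the polynomial parts match, `D L - M D` with `D = 1 + polePart p B B'` is a pole part. -/
lemma Matching.commutator {p : ℂ} {B B' : Mat} {l m : ℕ → Mat} (h : Matching p B B' l m)
    (hl : HasParity l) (hm : HasParity m) (κ : ℂ) (h1 : κ - p ≠ 0) (h2 : κ + p ≠ 0) :
    (1 + polePart p B B' κ) * laxPoly l κ
        + polePart p (laxPoly m p * B + laxPolyDeriv m p * B') (laxPoly m p * B') κ =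
      laxPoly m κ * (1 + polePart p B B' κ)
        + polePart p (B * laxPoly l p + B' * laxPolyDeriv l p) (B' * laxPoly l p) κ := by
  rw [Matrix.add_mul, Matrix.mul_add, polePart_mul_laxPoly p B B' κ h1 h2 l hl,
    laxPoly_mul_polePart p B B' κ h1 h2 m hm, Matrix.one_mul, Matrix.mul_one]
  generalize polePart p (laxPoly m p * B + laxPolyDeriv m p * B') (laxPoly m p * B') κ = X
  generalize polePart p (B * laxPoly l p + B' * laxPolyDeriv l p) (B' * laxPoly l p) κ = Y
  obtain ⟨e4, e3, e2, e1, e0⟩ := h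
  simp only [laxPoly, Finset.sum_range_succ, Finset.sum_range_zero]
  norm_num
  generalize infCoef p B B' = D at *
  ext i j
  have f := fun {X Y : Mat} (h : X = Y) => congrFun (congrFun h i) j
  have g4 := f e4
  have g3 := f e3
  have g2 := f e2
  have g1 := f e1
  have g0 := f e0
  simp only [Matrix.add_apply, Matrix.smul_apply, smul_eq_mul] at g3 g2 g1 g0 ⊢
  linear_combination g0 + κ * g1 + κ ^ 2 * g2 + κ ^ 3 * g3 + κ ^ 4 * g4

/-! ### The gauge transformation -/

/-- Along a Lax flow the residues of a dressing factor satisfy a Lax equation themselves. The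
difference of the two sides is a `jetPole` in the kernel of the nondegenerate linear system. -/
theorem residue_flow {p : ℂ} {y w z z' : ℝ → Vec} {zd zd' : Vec} {x : ℝ} {l m : ℕ → Mat}
    (hg : gap p ≠ 0) (hy0 : y x ≠ 0) (hl : HasParity l) (hm : HasParity m)
    (hskew : ∀ n, (l n)ᴴ = -l n)
    (hy : HasVecDeriv y (-(y x ᵥ* laxPoly l p)) x)
    (hw : HasVecDeriv w (-(w x ᵥ* laxPoly l p) - y x ᵥ* laxPolyDeriv l p) x)
    (hz : HasVecDeriv z zd x) (hz' : HasVecDeriv z' zd' x)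
    (kill : ∀ x, jetPole p (y x) (w x) (z x) (z' x) (conj p) *ᵥ star (y x) = -star (y x))
    (kill' : ∀ x, jetPole p (y x) (w x) (z x) (z' x) (conj p) *ᵥ star (w x)
      + jetPoleDeriv p (y x) (w x) (z x) (z' x) (conj p) *ᵥ star (y x) = -star (w x))
    {B B' : ℝ → Mat}
    (hB : ∀ x, B x = Matrix.vecMulVec (z x) (w x) + Matrix.vecMulVec (z' x) (y x))
    (hB' : ∀ x, B' x = Matrix.vecMulVec (z x) (y x))
    (hmatch : Matching p (B x) (B' x) l m) :
    HasMatDeriv B (laxPoly m p * B x + laxPolyDeriv m p * B' x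
      - (B x * laxPoly l p + B' x * laxPolyDeriv l p)) x ∧
    HasMatDeriv B' (laxPoly m p * B' x - B' x * laxPoly l p) x := by
  obtain rfl : B = _ := funext hB
  obtain rfl : B' = _ := funext hB'
  clear hB hB'
  obtain ⟨h5, h6⟩ := sub_ne_zero_of_gap p hg
  set B : Mat := Matrix.vecMulVec (z x) (w x) + Matrix.vecMulVec (z' x) (y x) with hB
  set B' : Mat := Matrix.vecMulVec (z x) (y x) with hB'
  -- the defects of the equations for `z` and `z'`
  set ζ : Vec := zd - laxPoly m p *ᵥ z x with hζ
  set ζ' : Vec := zd' - laxPoly m p *ᵥ z' x - laxPolyDeriv m p *ᵥ z x with hζ'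
  set X : Mat := laxPoly m p * B + laxPolyDeriv m p * B' with hX
  set X' : Mat := laxPoly m p * B' with hX'
  set Y : Mat := B * laxPoly l p + B' * laxPolyDeriv l p with hY
  set Y' : Mat := B' * laxPoly l p with hY'
  set Z : Mat := Matrix.vecMulVec ζ (w x) + Matrix.vecMulVec ζ' (y x) with hZ
  set Z' : Mat := Matrix.vecMulVec ζ (y x) with hZ'
  have dB' : HasMatDeriv (fun x => Matrix.vecMulVec (z x) (y x)) (Z' + (X' - Y')) x := by
    convert hz.vecMulVec hy using 1
    simp only [hZ', hX', hY', hζ, hB', Matrix.sub_vecMulVec, Matrix.vecMulVec_neg,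
      Matrix.vecMulVec_mul, Matrix.mul_vecMulVec]
    abel
  have dB : HasMatDeriv (fun x => Matrix.vecMulVec (z x) (w x) + Matrix.vecMulVec (z' x) (y x))
      (Z + (X - Y)) x := by
    convert (hz.vecMulVec hw).add (hz'.vecMulVec hy) using 1
    simp only [hZ, hX, hY, hζ, hζ', hB, hB', Matrix.sub_vecMulVec, Matrix.vecMulVec_neg,
      Matrix.vecMulVec_sub, Matrix.mul_add, Matrix.add_mul,
      Matrix.vecMulVec_mul, Matrix.mul_vecMulVec]
    abel
  -- the defect of the Lax equation is the pole part with residues `Z`, `Z'`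
  have F : ∀ κ, κ - p ≠ 0 → κ + p ≠ 0 →
      polePart p (Z + (X - Y)) (Z' + (X' - Y')) κ + (1 + polePart p B B' κ) * laxPoly l κ
        - laxPoly m κ * (1 + polePart p B B' κ) = polePart p Z Z' κ := by
    intro κ k1 k2
    have := hmatch.commutator hl hm κ k1 k2
    rw [polePart_add, sub_eq_add_neg X, sub_eq_add_neg X', polePart_add, polePart_neg]
    rw [← sub_eq_zero] at this ⊢
    rw [← this]
    abel
  have F0 := F (conj p) h5 h6
  have dD : HasMatDeriv (fun κ => 1 + polePart p B B' κ) (polePartDeriv p B B' (conj p))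
      (conj p) := by
    simpa using (hasMatDeriv_const 1 _).add (hasMatDeriv_polePart p B B' (conj p) h5 h6)
  have F1 : polePartDeriv p (Z + (X - Y)) (Z' + (X' - Y')) (conj p)
      + (polePartDeriv p B B' (conj p) * laxPoly l (conj p)
        + (1 + polePart p B B' (conj p)) * laxPolyDeriv l (conj p))
      - (laxPolyDeriv m (conj p) * (1 + polePart p B B' (conj p))
        + laxPoly m (conj p) * polePartDeriv p B B' (conj p))
      = polePartDeriv p Z Z' (conj p) := by
    have L := ((hasMatDeriv_polePart p (Z + (X - Y)) (Z' + (X' - Y')) (conj p) h5 h6).add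
      (dD.mul (hasMatDeriv_laxPoly l (conj p)))).sub ((hasMatDeriv_laxPoly m (conj p)).mul dD)
    refine L.unique ?_
    intro i j
    refine (hasMatDeriv_polePart p Z Z' (conj p) h5 h6 i j).congr_of_eventuallyEq ?_
    have n1 : ∀ᶠ κ in 𝓝 (conj p), κ - p ≠ 0 :=
      (continuous_id.sub continuous_const).continuousAt.eventually_ne h5
    have n2 : ∀ᶠ κ in 𝓝 (conj p), κ + p ≠ 0 :=
      (continuous_id.add continuous_const).continuousAt.eventually_ne h6
    filter_upwards [n1, n2] with κ k1 k2
    rw [← F κ k1 k2]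
  have sy : star (y x ᵥ* laxPoly l p) = -(laxPoly l (conj p) *ᵥ star (y x)) := by
    rw [Matrix.star_vecMul, laxPoly_conjTranspose l hskew, Matrix.neg_mulVec]
  have sw : star (w x ᵥ* laxPoly l p) = -(laxPoly l (conj p) *ᵥ star (w x)) := by
    rw [Matrix.star_vecMul, laxPoly_conjTranspose l hskew, Matrix.neg_mulVec]
  have sy' : star (y x ᵥ* laxPolyDeriv l p) = -(laxPolyDeriv l (conj p) *ᵥ star (y x)) := by
    rw [Matrix.star_vecMul, laxPolyDeriv_conjTranspose l hskew, Matrix.neg_mulVec]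
  have dy : HasVecDeriv (fun x => star (y x)) (laxPoly l (conj p) *ᵥ star (y x)) x := by
    convert hy.star using 1
    rw [star_neg, sy, neg_neg]
  have dw : HasVecDeriv (fun x => star (w x))
      (laxPoly l (conj p) *ᵥ star (w x) + laxPolyDeriv l (conj p) *ᵥ star (y x)) x := by
    convert hw.star using 1
    rw [star_sub, star_neg, sw, sy', neg_neg, sub_neg_eq_add]
  -- the derivatives of the kernel conditions
  have K0 : (1 + polePart p B B' (conj p)) *ᵥ star (y x) = 0 := by
    rw [Matrix.add_mulVec, Matrix.one_mulVec]
    exact add_eq_zero_iff_eq_neg'.2 (kill x)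
  have K1 : (1 + polePart p B B' (conj p)) *ᵥ star (w x)
      + polePartDeriv p B B' (conj p) *ᵥ star (y x) = 0 := by
    rw [Matrix.add_mulVec, Matrix.one_mulVec, add_assoc]
    exact add_eq_zero_iff_eq_neg'.2 (kill' x)
  have dK0 : polePart p (Z + (X - Y)) (Z' + (X' - Y')) (conj p) *ᵥ star (y x)
      + (1 + polePart p B B' (conj p)) *ᵥ (laxPoly l (conj p) *ᵥ star (y x)) = 0 := by
    have L := ((hasMatDeriv_const 1 x).add (dB.polePart dB' p (conj p))).mulVec dy
    rw [zero_add] at L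
    refine L.unique ?_
    have : (fun x => (1 + polePart p (Matrix.vecMulVec (z x) (w x) + Matrix.vecMulVec (z' x) (y x))
        (Matrix.vecMulVec (z x) (y x)) (conj p)) *ᵥ star (y x)) = fun _ => 0 := by
      funext x
      rw [Matrix.add_mulVec, Matrix.one_mulVec]
      exact add_eq_zero_iff_eq_neg'.2 (kill x)
    rw [this]
    exact hasVecDeriv_const 0 x
  have dK1 : polePart p (Z + (X - Y)) (Z' + (X' - Y')) (conj p) *ᵥ star (w x)
      + (1 + polePart p B B' (conj p)) *ᵥ
        (laxPoly l (conj p) *ᵥ star (w x) + laxPolyDeriv l (conj p) *ᵥ star (y x))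
      + (polePartDeriv p (Z + (X - Y)) (Z' + (X' - Y')) (conj p) *ᵥ star (y x)
      + polePartDeriv p B B' (conj p) *ᵥ (laxPoly l (conj p) *ᵥ star (y x))) = 0 := by
    have L := (((hasMatDeriv_const 1 x).add (dB.polePart dB' p (conj p))).mulVec dw).add
      ((dB.polePartDeriv dB' p (conj p)).mulVec dy)
    rw [zero_add] at L
    refine L.unique ?_
    have : (fun x => (1 + polePart p (Matrix.vecMulVec (z x) (w x) + Matrix.vecMulVec (z' x) (y x))
        (Matrix.vecMulVec (z x) (y x)) (conj p)) *ᵥ star (w x) +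
        polePartDeriv p (Matrix.vecMulVec (z x) (w x) + Matrix.vecMulVec (z' x) (y x))
        (Matrix.vecMulVec (z x) (y x)) (conj p) *ᵥ star (y x)) = fun _ => 0 := by
      funext x
      rw [Matrix.add_mulVec, Matrix.one_mulVec, add_assoc]
      exact add_eq_zero_iff_eq_neg'.2 (kill' x)
    rw [this]
    exact hasVecDeriv_const 0 x
  have J0 : polePart p Z Z' (conj p) *ᵥ star (y x) = 0 := by
    rw [← F0, Matrix.sub_mulVec, Matrix.add_mulVec, ← Matrix.mulVec_mulVec, dK0,
      ← Matrix.mulVec_mulVec, K0]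
    simp
  have J1 : polePart p Z Z' (conj p) *ᵥ star (w x)
      + polePartDeriv p Z Z' (conj p) *ᵥ star (y x) = 0 := by
    rw [← F0, ← F1]
    generalize 1 + polePart p B B' (conj p) = D at *
    generalize polePartDeriv p B B' (conj p) = D' at *
    have K0' := congrArg (laxPolyDeriv m (conj p) *ᵥ ·) K0
    have K1' := congrArg (laxPoly m (conj p) *ᵥ ·) K1
    simp only [Matrix.mulVec_add, Matrix.mulVec_zero] at K0' K1' dK1
    simp only [Matrix.sub_mulVec, Matrix.add_mulVec, ← Matrix.mulVec_mulVec]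
    linear_combination dK1 - K0' - K1'
  obtain ⟨z1, z2⟩ := jetPole_injective p (y x) (w x) ζ ζ' hy0 hg J0 J1
  have Z0 : Z = 0 := by rw [hZ, z1, z2]; simp
  have Z0' : Z' = 0 := by rw [hZ', z1]; simp
  rw [Z0, zero_add] at dB
  rw [Z0', zero_add] at dB'
  exact ⟨dB, dB'⟩

/-! ### The coefficients of the Lax pair -/

/-- The coefficients of `U - i κ² σ₃` where `q = a`. -/
def xCoef (a : ℂ) : ℕ → Mat
  | 0 => !![Complex.I / 2 * (a * conj a), 0; 0, -(Complex.I / 2 * (a * conj a))]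
  | 1 => !![0, a; -conj a, 0]
  | 2 => !![-Complex.I, 0; 0, Complex.I]
  | _ => 0

/-- The coefficients of `V - 2 i κ⁴ σ₃` where `q = a` and `q_x = b`. -/
def tCoef (a b : ℂ) : ℕ → Mat
  | 0 => !![(a * conj b - b * conj a) / 2 + Complex.I / 4 * (a * conj a) ^ 2, 0;
      0, -((a * conj b - b * conj a) / 2 + Complex.I / 4 * (a * conj a) ^ 2)]
  | 1 => !![0, Complex.I * b; Complex.I * conj b, 0]
  | 2 => !![Complex.I * (a * conj a), 0; 0, -(Complex.I * (a * conj a))]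
  | 3 => !![0, 2 * a; -(2 * conj a), 0]
  | 4 => !![-(2 * Complex.I), 0; 0, 2 * Complex.I]
  | _ => 0

lemma xCoef_hasParity (a : ℂ) : HasParity (xCoef a) := by
  intro n
  ext i j
  rw [sigma3_conj_apply]
  match n with
  | 0 | 1 | 2 => fin_cases i <;> fin_cases j <;> simp [xCoef]
  | n + 3 => simp [xCoef]

lemma tCoef_hasParity (a b : ℂ) : HasParity (tCoef a b) := by
  intro n
  ext i j
  rw [sigma3_conj_apply]
  match n with
  | 0 | 1 | 2 | 3 | 4 => fin_cases i <;> fin_cases j <;> simp [tCoef, pow_succ]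
  | n + 5 => simp [tCoef]

lemma conj_two : conj (2 : ℂ) = 2 := map_ofNat _ 2

lemma conj_four : conj (4 : ℂ) = 4 := map_ofNat _ 4

lemma xCoef_skew (a : ℂ) (n : ℕ) : (xCoef a n)ᴴ = -xCoef a n := by
  ext i j
  rw [Matrix.conjTranspose_apply, ← starRingEnd_apply]
  match n with
  | 0 | 1 | 2 =>
    fin_cases i <;> fin_cases j <;> simp [xCoef, conj_two] <;> ring
  | n + 3 => simp [xCoef]

lemma tCoef_skew (a b : ℂ) (n : ℕ) : (tCoef a b n)ᴴ = -tCoef a b n := by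
  ext i j
  rw [Matrix.conjTranspose_apply, ← starRingEnd_apply]
  match n with
  | 0 | 1 | 2 | 3 | 4 =>
    fin_cases i <;> fin_cases j <;> simp [tCoef, conj_two, conj_four] <;> ring
  | n + 5 => simp [tCoef]

lemma laxU_eq (q : ℝ → ℝ → ℂ) (x t : ℝ) (κ : ℂ) :
    laxU q x t κ - (Complex.I * κ ^ 2) • sigma3 = laxPoly (xCoef (q x t)) κ := by
  ext i j
  fin_cases i <;> fin_cases j <;>
    simp [laxU, laxPoly, xCoef, potential, sigma3, Finset.sum_range_succ, pow_two] <;>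
    ring

lemma realDeriv_potential (q : ℝ → ℝ → ℂ) (x t : ℝ) :
    realDeriv (fun x' => potential q x' t) x =
      !![0, deriv (fun x' => q x' t) x; -conj (deriv (fun x' => q x' t) x), 0] := by
  have h : deriv (fun x' => conj (q x' t)) x = conj (deriv (fun x' => q x' t) x) :=
    deriv.star
  ext i j
  fin_cases i <;> fin_cases j <;> simp [realDeriv, potential, h]

lemma laxV_eq (q : ℝ → ℝ → ℂ) (x t : ℝ) (κ : ℂ) :
    laxV q x t κ - (2 * Complex.I * κ ^ 4) • sigma3
      = laxPoly (tCoef (q x t) (deriv (fun x' => q x' t) x)) κ := by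
  rw [laxV, realDeriv_potential]
  have e4 : ∀ A : Mat, A ^ 4 = A * A * (A * A) := fun A => by rw [← pow_two, ← pow_two, ← pow_mul]
  ext i j
  fin_cases i <;> fin_cases j <;>
    simp [laxPoly, tCoef, potential, sigma3, Finset.sum_range_succ, e4, pow_two] <;>
    ring

/-! ### Matching of the polynomial parts -/

lemma mat_ext {a b c d a' b' c' d' : ℂ} (h1 : a = a') (h2 : b = b') (h3 : c = c') (h4 : d = d') :
    (!![a, b; c, d] : Mat) = !![a', b'; c', d'] := by
  rw [h1, h2, h3, h4]

lemma infCoef_zero (p : ℂ) (B B' : Mat) :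
    infCoef p B B' 0 = !![0, 2 * B 0 1; 2 * B 1 0, 0] := by
  rw [Matrix.eta_fin_two (infCoef _ _ _ _)]
  apply mat_ext <;> simp only [infCoef, Matrix.of_apply, sgn_zero, sgn_one] <;> push_cast <;> ring

lemma infCoef_one (p : ℂ) (B B' : Mat) :
    infCoef p B B' 1 = !![2 * (p * B 0 0 + B' 0 0), 0; 0, 2 * (p * B 1 1 + B' 1 1)] := by
  rw [Matrix.eta_fin_two (infCoef _ _ _ _)]
  apply mat_ext <;> simp only [infCoef, Matrix.of_apply, sgn_zero, sgn_one] <;> push_cast <;> ring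

lemma infCoef_two (p : ℂ) (B B' : Mat) :
    infCoef p B B' 2 = !![0, 2 * (p ^ 2 * B 0 1 + 2 * p * B' 0 1);
      2 * (p ^ 2 * B 1 0 + 2 * p * B' 1 0), 0] := by
  rw [Matrix.eta_fin_two (infCoef _ _ _ _)]
  apply mat_ext <;> simp only [infCoef, Matrix.of_apply, sgn_zero, sgn_one] <;> push_cast <;> ring

lemma infCoef_three (p : ℂ) (B B' : Mat) :
    infCoef p B B' 3 = !![2 * (p ^ 3 * B 0 0 + 3 * p ^ 2 * B' 0 0), 0;
      0, 2 * (p ^ 3 * B 1 1 + 3 * p ^ 2 * B' 1 1)] := by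
  rw [Matrix.eta_fin_two (infCoef _ _ _ _)]
  apply mat_ext <;> simp only [infCoef, Matrix.of_apply, sgn_zero, sgn_one] <;> push_cast <;> ring

lemma add_fin_two (a b c d a' b' c' d' : ℂ) :
    (!![a, b; c, d] : Mat) + !![a', b'; c', d'] = !![a + a', b + b'; c + c', d + d'] := by
  simp

lemma zero_fin_two : (0 : Mat) = !![0, 0; 0, 0] := by
  ext i j
  fin_cases i <;> fin_cases j <;> rfl

lemma I_pow_five : Complex.I ^ 5 = Complex.I := by
  rw [pow_succ, Complex.I_pow_four, one_mul]

lemma matching_x (p a a' : ℂ) (B B' : Mat) (hB : B 1 0 = -conj (B 0 1))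
    (ha : a' = a + 4 * Complex.I * B 0 1) : Matching p B B' (xCoef a) (xCoef a') := by
  have hc : conj a' = conj a + 4 * Complex.I * B 1 0 := by
    rw [ha, hB]
    simp [conj_four]
  constructor <;> simp only [infCoef_zero, infCoef_one, infCoef_two, infCoef_three, xCoef,
    zero_fin_two, Matrix.mul_fin_two, add_fin_two, hc] <;> clear hc hB <;>
    generalize conj a' = c' <;> subst ha <;> apply mat_ext <;>
    ring_nf <;> simp only [Complex.I_sq, Complex.I_pow_three] <;> ring

lemma matching_t (p a a' b b' : ℂ) (B B' : Mat) (hB : B 1 0 = -conj (B 0 1))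
    (ha : a' = a + 4 * Complex.I * B 0 1)
    {X : Mat} (hX : X = laxPoly (xCoef a') p * B + laxPolyDeriv (xCoef a') p * B'
      - (B * laxPoly (xCoef a) p + B' * laxPolyDeriv (xCoef a) p))
    (hX' : X 1 0 = -conj (X 0 1)) (hb : b' = b + 4 * Complex.I * X 0 1) :
    Matching p B B' (tCoef a b) (tCoef a' b') := by
  have hc : conj a' = conj a + 4 * Complex.I * B 1 0 := by
    rw [ha, hB]
    simp [conj_four]
  have hd : conj b' = conj b + 4 * Complex.I * X 1 0 := by
    rw [hb, hX']
    simp [conj_four]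
  have x01 := congrFun (congrFun hX 0) 1
  have x10 := congrFun (congrFun hX 1) 0
  simp only [laxPoly, laxPolyDeriv, Finset.sum_range_succ, Finset.sum_range_zero, xCoef,
    Matrix.sub_apply, Matrix.add_apply, Matrix.mul_apply, Fin.sum_univ_two, Matrix.smul_apply,
    Matrix.of_apply, Matrix.cons_val', Matrix.cons_val_zero, Matrix.cons_val_one,
    Matrix.zero_apply, Matrix.cons_val_fin_one, smul_eq_mul, hc] at x01 x10
  rw [x01] at hb
  rw [x10] at hd
  clear x01 x10 hX hX' hB
  constructor <;> simp only [infCoef_zero, infCoef_one, infCoef_two, infCoef_three, tCoef,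
    Matrix.mul_fin_two, add_fin_two] <;>
    generalize conj a' = ac' at * <;> generalize conj b' = bc' at * <;>
    generalize conj a = ac at * <;> generalize conj b = bc at * <;>
    subst hb <;> subst hd <;> subst ha <;> subst hc <;> apply mat_ext <;>
    ring_nf <;> (try simp only [Complex.I_sq, Complex.I_pow_three, Complex.I_pow_four, I_pow_five]) <;> ring

/-! ### Mixed partial derivatives -/

lemma two_le_smooth : (2 : WithTop ℕ∞) ≤ ∞ := by
  norm_cast

/-- Symmetry of second derivatives along two curves through a point. -/
lemma hasDerivAt_fderiv_of_symm {E : Type*} [NormedAddCommGroup E] [NormedSpace ℝ E] {g : E → ℂ}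
    {P v e : E} (hg : ContDiffAt ℝ 2 g P) {γ δ : ℝ → E} {s₀ r₀ : ℝ}
    (hγ : HasDerivAt γ v s₀) (hγ0 : γ s₀ = P) (hδ : HasDerivAt δ e r₀) (hδ0 : δ r₀ = P)
    {h : ℝ → ℂ} {h' : ℂ} (hh : ∀ᶠ r in 𝓝 r₀, fderiv ℝ g (δ r) v = h r)
    (hd : HasDerivAt h h' r₀) :
    HasDerivAt (fun s => fderiv ℝ g (γ s) e) h' s₀ := by
  have d2 : HasFDerivAt (fderiv ℝ g) (fderiv ℝ (fderiv ℝ g) P) P :=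
    ((hg.fderiv_right (m := 1) (by norm_num)).differentiableAt (by norm_num)).hasFDerivAt
  have dγ : HasDerivAt (fun s => fderiv ℝ g (γ s)) (fderiv ℝ (fderiv ℝ g) P v) s₀ := by
    subst hγ0
    exact d2.comp_hasDerivAt s₀ hγ
  have dδ : HasDerivAt (fun s => fderiv ℝ g (δ s)) (fderiv ℝ (fderiv ℝ g) P e) r₀ := by
    subst hδ0
    exact d2.comp_hasDerivAt r₀ hδ
  have symm := hg.isSymmSndFDerivAt (by simp) v e
  have a1 : HasDerivAt (fun s => fderiv ℝ g (γ s) e) (fderiv ℝ (fderiv ℝ g) P v e) s₀ := by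
    simpa using dγ.clm_apply (hasDerivAt_const s₀ e)
  have a2 : HasDerivAt (fun s => fderiv ℝ g (δ s) v) (fderiv ℝ (fderiv ℝ g) P e v) r₀ := by
    simpa using dδ.clm_apply (hasDerivAt_const r₀ v)
  have := (a2.congr_of_eventuallyEq (hh.mono fun r hr => hr.symm)).unique hd
  rwa [symm, this] at a1

/-! ### The jet of the row vectors along the Lax flows -/

section eigen

variable {S : Set ℂ} {q : ℝ → ℝ → ℂ} {ψ : ℝ → ℝ → ℂ → Mat}

lemma isOpen_univ_prod (hS : IsOpen S) : IsOpen (Set.univ ×ˢ Set.univ ×ˢ S : Set (ℝ × ℝ × ℂ)) :=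
  isOpen_univ.prod (isOpen_univ.prod hS)

/-- An entry of `ψ` as a function of all the variables. -/
def jointEntry (ψ : ℝ → ℝ → ℂ → Mat) (a b : Fin 2) (P : ℝ × ℝ × ℂ) : ℂ := ψ P.1 P.2.1 P.2.2 a b

lemma IsEigenfunction.contDiffAt (h : IsEigenfunction S q ψ) (hS : IsOpen S) (x t : ℝ) {κ : ℂ}
    (hκ : κ ∈ S) (a b : Fin 2) : ContDiffAt ℝ ∞ (jointEntry ψ a b) (x, t, κ) :=
  (h.smooth a b).contDiffAt ((isOpen_univ_prod hS).mem_nhds (by simp [hκ]))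

lemma IsEigenfunction.hasFDerivAt (h : IsEigenfunction S q ψ) (hS : IsOpen S) (x t : ℝ) {κ : ℂ}
    (hκ : κ ∈ S) (a b : Fin 2) : HasFDerivAt (jointEntry ψ a b)
      (fderiv ℝ (jointEntry ψ a b) (x, t, κ)) (x, t, κ) :=
  ((h.contDiffAt hS x t hκ a b).differentiableAt (by simp)).hasFDerivAt

lemma IsEigenfunction.hasMatDeriv_spectral (h : IsEigenfunction S q ψ) (hS : IsOpen S) (x t : ℝ)
    {κ : ℂ} (hκ : κ ∈ S) : HasMatDeriv (ψ x t) (cplxDeriv (ψ x t) κ) κ :=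
  fun a b => ((h.holo x t a b).differentiableAt (hS.mem_nhds hκ)).hasDerivAt

lemma hasDerivAt_curve_x (x t : ℝ) (κ : ℂ) :
    HasDerivAt (fun x' : ℝ => (x', t, κ)) ((1, 0, 0) : ℝ × ℝ × ℂ) x :=
  (hasDerivAt_id x).prodMk ((hasDerivAt_const x t).prodMk (hasDerivAt_const x κ))

lemma hasDerivAt_curve_t (x t : ℝ) (κ : ℂ) :
    HasDerivAt (fun t' : ℝ => (x, t', κ)) ((0, 1, 0) : ℝ × ℝ × ℂ) t :=
  (hasDerivAt_const t x).prodMk ((hasDerivAt_id t).prodMk (hasDerivAt_const t κ))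

lemma hasDerivAt_curve_spectral (x t : ℝ) (κ : ℂ) :
    HasDerivAt (fun r : ℝ => (x, t, κ + (r : ℂ))) ((0, 0, 1) : ℝ × ℝ × ℂ) 0 :=
  (hasDerivAt_const 0 x).prodMk ((hasDerivAt_const 0 t).prodMk
    (Complex.ofRealCLM.hasDerivAt.const_add κ))

lemma hasDerivAt_comp_spectral {f : ℂ → ℂ} {f' κ : ℂ} (hf : HasDerivAt f f' κ) :
    HasDerivAt (fun r : ℝ => f (κ + (r : ℂ))) f' 0 := by
  have h1 : HasDerivAt (fun z : ℂ => f (κ + z)) f' ((0 : ℝ) : ℂ) := by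
    apply HasDerivAt.comp_const_add
    simpa using hf
  exact h1.comp_ofReal

lemma IsEigenfunction.cplxDeriv_apply (h : IsEigenfunction S q ψ) (hS : IsOpen S) (x t : ℝ)
    {κ : ℂ} (hκ : κ ∈ S) (a b : Fin 2) :
    cplxDeriv (ψ x t) κ a b = fderiv ℝ (jointEntry ψ a b) (x, t, κ) (0, 0, 1) := by
  have h1 := hasDerivAt_comp_spectral (h.hasMatDeriv_spectral hS x t hκ a b)
  have h2 := HasFDerivAt.comp_hasDerivAt (f := fun r : ℝ => (x, t, κ + (r : ℂ))) 0
    (by simpa using h.hasFDerivAt hS x t hκ a b) (hasDerivAt_curve_spectral x t κ)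
  exact h1.unique h2

lemma IsEigenfunction.hasDerivAt_entry_x (h : IsEigenfunction S q ψ) (hS : IsOpen S) (x t : ℝ)
    {κ : ℂ} (hκ : κ ∈ S) (a b : Fin 2) :
    HasDerivAt (fun x' => ψ x' t κ a b) (fderiv ℝ (jointEntry ψ a b) (x, t, κ) (1, 0, 0)) x :=
  HasFDerivAt.comp_hasDerivAt (f := fun x' : ℝ => (x', t, κ)) x (h.hasFDerivAt hS x t hκ a b)
    (hasDerivAt_curve_x x t κ)

lemma IsEigenfunction.hasDerivAt_entry_t (h : IsEigenfunction S q ψ) (hS : IsOpen S) (x t : ℝ)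
    {κ : ℂ} (hκ : κ ∈ S) (a b : Fin 2) :
    HasDerivAt (fun t' => ψ x t' κ a b) (fderiv ℝ (jointEntry ψ a b) (x, t, κ) (0, 1, 0)) t :=
  HasFDerivAt.comp_hasDerivAt (f := fun t' : ℝ => (x, t', κ)) t (h.hasFDerivAt hS x t hκ a b)
    (hasDerivAt_curve_t x t κ)

lemma IsEigenfunction.hasMatDeriv_x (h : IsEigenfunction S q ψ) (hS : IsOpen S) (x t : ℝ)
    {κ : ℂ} (hκ : κ ∈ S) :
    HasMatDeriv (fun x' => ψ x' t κ) (laxPoly (xCoef (q x t)) κ * ψ x t κ) x := by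
  have e : laxPoly (xCoef (q x t)) κ * ψ x t κ = realDeriv (fun x' => ψ x' t κ) x := by
    rw [← laxU_eq, Matrix.sub_mul, ← h.lax_x x t κ hκ, Matrix.smul_mul]
    abel
  rw [e]
  exact fun a b => (h.hasDerivAt_entry_x hS x t hκ a b).differentiableAt.hasDerivAt

lemma IsEigenfunction.hasMatDeriv_t (h : IsEigenfunction S q ψ) (hS : IsOpen S) (x t : ℝ)
    {κ : ℂ} (hκ : κ ∈ S) :
    HasMatDeriv (fun t' => ψ x t' κ)
      (laxPoly (tCoef (q x t) (deriv (fun x' => q x' t) x)) κ * ψ x t κ) t := by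
  have e : laxPoly (tCoef (q x t) (deriv (fun x' => q x' t) x)) κ * ψ x t κ
      = realDeriv (fun t' => ψ x t' κ) t := by
    rw [← laxV_eq, Matrix.sub_mul, ← h.lax_t x t κ hκ, Matrix.smul_mul]
    abel
  rw [e]
  exact fun a b => (h.hasDerivAt_entry_t hS x t hκ a b).differentiableAt.hasDerivAt

/-- Differentiation of a Lax equation in the spectral parameter, along a curve of constant spectral
parameter. -/
lemma IsEigenfunction.hasMatDeriv_cplxDeriv (h : IsEigenfunction S q ψ) (hS : IsOpen S) (x t : ℝ)
    {κ : ℂ} (hκ : κ ∈ S) {c : ℝ → ℝ × ℝ} {v : ℝ × ℝ × ℂ} {s : ℝ} (hs : c s = (x, t))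
    (hc : ∀ κ, HasDerivAt (fun s => ((c s).1, (c s).2, κ)) v s) {l : ℕ → Mat}
    (hl : ∀ κ ∈ S, HasMatDeriv (fun s => ψ (c s).1 (c s).2 κ) (laxPoly l κ * ψ x t κ) s) :
    HasMatDeriv (fun s => cplxDeriv (ψ (c s).1 (c s).2) κ)
      (laxPolyDeriv l κ * ψ x t κ + laxPoly l κ * cplxDeriv (ψ x t) κ) s := by
  intro a b
  have hv : ∀ κ ∈ S, fderiv ℝ (jointEntry ψ a b) (x, t, κ) v = (laxPoly l κ * ψ x t κ) a b := by
    intro κ hκ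
    have h1 := HasFDerivAt.comp_hasDerivAt (f := fun s => ((c s).1, (c s).2, κ)) s
      (by simpa [hs] using h.hasFDerivAt hS x t hκ a b) (hc κ)
    exact h1.unique (hl κ hκ a b)
  have hd := hasDerivAt_comp_spectral
    (((hasMatDeriv_laxPoly l κ).mul (h.hasMatDeriv_spectral hS x t hκ)) a b)
  have near : ∀ᶠ r : ℝ in 𝓝 0, κ + (r : ℂ) ∈ S := by
    have : ContinuousAt (fun r : ℝ => κ + (r : ℂ)) 0 := by fun_prop
    exact this.eventually_mem (hS.mem_nhds (by simpa using hκ))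
  have key := hasDerivAt_fderiv_of_symm (g := jointEntry ψ a b) (P := (x, t, κ))
    ((h.contDiffAt hS x t hκ a b).of_le two_le_smooth) (hc κ) (by simp [hs])
    (hasDerivAt_curve_spectral x t κ) (by simp) (near.mono fun r hr => hv _ hr) hd
  refine key.congr_of_eventuallyEq (Eventually.of_forall fun s => ?_)
  exact h.cplxDeriv_apply hS _ _ hκ a b

/-! ### The row vectors -/

lemma IsEigenfunction.inv_eq (h : IsEigenfunction S q ψ) (x t : ℝ) {κ : ℂ} (hκ : κ ∈ S) :
    (ψ x t κ)⁻¹ = (ψ x t (conj κ))ᴴ :=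
  Matrix.inv_eq_right_inv (h.unitarity x t κ hκ)

lemma IsEigenfunction.cplxDeriv_inv (h : IsEigenfunction S q ψ) (hS : IsOpen S)
    (hS' : ∀ κ ∈ S, conj κ ∈ S) (x t : ℝ) {κ : ℂ} (hκ : κ ∈ S) :
    cplxDeriv (fun κ => (ψ x t κ)⁻¹) κ = (cplxDeriv (ψ x t) (conj κ))ᴴ := by
  ext a b
  have e : (fun κ => (ψ x t κ)⁻¹ a b) =ᶠ[𝓝 κ] fun κ => conj (ψ x t (conj κ) b a) := by
    filter_upwards [hS.mem_nhds hκ] with κ' hκ'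
    rw [h.inv_eq x t hκ']
    rfl
  have d := (h.hasMatDeriv_spectral hS x t (hS' κ hκ) b a).conj_conj
  rw [Complex.conj_conj] at d
  exact (d.congr_of_eventuallyEq e).deriv

lemma IsEigenfunction.star_yVec (h : IsEigenfunction S q ψ) (x t : ℝ) {p : ℂ} (hp : p ∈ S)
    (Υ : Vec) : star (yVec p Υ (ψ x t)) = ψ x t (conj p) *ᵥ star Υ := by
  rw [yVec, h.inv_eq x t hp, Matrix.star_vecMul, Matrix.conjTranspose_conjTranspose]

lemma IsEigenfunction.star_yTildeVec (h : IsEigenfunction S q ψ) (hS : IsOpen S)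
    (hS' : ∀ κ ∈ S, conj κ ∈ S) (x t : ℝ) {p : ℂ} (hp : p ∈ S) (Υ Υ' : Vec) :
    star (yTildeVec p Υ Υ' (ψ x t)) = ψ x t (conj p) *ᵥ star Υ'
      + cplxDeriv (ψ x t) (conj p) *ᵥ star Υ := by
  rw [yTildeVec, h.inv_eq x t hp, h.cplxDeriv_inv hS hS' x t hp, star_add, Matrix.star_vecMul,
    Matrix.star_vecMul, Matrix.conjTranspose_conjTranspose, Matrix.conjTranspose_conjTranspose]

lemma IsEigenfunction.yVec_ne_zero (h : IsEigenfunction S q ψ) (x t : ℝ) {p : ℂ} (hp : p ∈ S)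
    {Υ : Vec} (hΥ : Υ ≠ 0) : yVec p Υ (ψ x t) ≠ 0 := by
  intro h0
  apply hΥ
  have h1 : (ψ x t p)⁻¹ * ψ x t p = 1 := by
    rw [h.inv_eq x t hp]
    exact mul_eq_one_comm.1 (h.unitarity x t p hp)
  have : yVec p Υ (ψ x t) ᵥ* ψ x t p = Υ := by
    rw [yVec, Matrix.vecMul_vecMul, h1, Matrix.vecMul_one]
  rw [← this, h0, Matrix.zero_vecMul]

/-- Along a Lax flow, `y` and `w` satisfy the adjoint equation and its derivative in the spectral
parameter. -/
lemma IsEigenfunction.hasVecDeriv_yVec (h : IsEigenfunction S q ψ) (hS : IsOpen S)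
    (hS' : ∀ κ ∈ S, conj κ ∈ S) (x t : ℝ) {p : ℂ} (hp : p ∈ S) (Υ Υ' : Vec)
    {c : ℝ → ℝ × ℝ} {v : ℝ × ℝ × ℂ} {s : ℝ} (hs : c s = (x, t))
    (hc : ∀ κ, HasDerivAt (fun s => ((c s).1, (c s).2, κ)) v s) {l : ℕ → Mat}
    (hskew : ∀ n, (l n)ᴴ = -l n)
    (hl : ∀ κ ∈ S, HasMatDeriv (fun s => ψ (c s).1 (c s).2 κ) (laxPoly l κ * ψ x t κ) s) :
    HasVecDeriv (fun s => yVec p Υ (ψ (c s).1 (c s).2))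
      (-(yVec p Υ (ψ x t) ᵥ* laxPoly l p)) s ∧
    HasVecDeriv (fun s => yTildeVec p Υ Υ' (ψ (c s).1 (c s).2))
      (-(yTildeVec p Υ Υ' (ψ x t) ᵥ* laxPoly l p) - yVec p Υ (ψ x t) ᵥ* laxPolyDeriv l p) s := by
  have hp' := hS' p hp
  have skew : (laxPoly l (conj p))ᴴ = -laxPoly l p := by
    rw [laxPoly_conjTranspose l hskew, Complex.conj_conj]
  have skew' : (laxPolyDeriv l (conj p))ᴴ = -laxPolyDeriv l p := by
    rw [laxPolyDeriv_conjTranspose l hskew, Complex.conj_conj]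
  have e1 : ∀ s, yVec p Υ (ψ (c s).1 (c s).2)
      = star (ψ (c s).1 (c s).2 (conj p) *ᵥ star Υ) := fun s => by
    rw [← h.star_yVec _ _ hp, star_star]
  have e2 : ∀ s, yTildeVec p Υ Υ' (ψ (c s).1 (c s).2)
      = star (ψ (c s).1 (c s).2 (conj p) *ᵥ star Υ'
        + cplxDeriv (ψ (c s).1 (c s).2) (conj p) *ᵥ star Υ) := fun s => by
    rw [← h.star_yTildeVec hS hS' _ _ hp, star_star]
  have d1 := (hl _ hp').mulVec (hasVecDeriv_const (star Υ) s)
  have d2 := ((hl _ hp').mulVec (hasVecDeriv_const (star Υ') s)).add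
    ((h.hasMatDeriv_cplxDeriv hS x t hp' hs hc hl).mulVec (hasVecDeriv_const (star Υ) s))
  simp only [Matrix.mulVec_zero, add_zero] at d1 d2
  constructor
  · simp only [e1]
    convert d1.star using 1
    rw [← Matrix.mulVec_mulVec, ← h.star_yVec x t hp, Matrix.star_mulVec, star_star, skew,
      Matrix.vecMul_neg]
  · simp only [e2]
    convert d2.star using 1
    rw [Matrix.add_mulVec, ← Matrix.mulVec_mulVec, ← Matrix.mulVec_mulVec, ← Matrix.mulVec_mulVec,
      add_left_comm, ← Matrix.mulVec_add, ← h.star_yTildeVec hS hS' x t hp, ← h.star_yVec x t hp,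
      star_add, Matrix.star_mulVec, Matrix.star_mulVec, star_star, star_star, skew, skew',
      Matrix.vecMul_neg, Matrix.vecMul_neg]
    abel

end eigen

/-! ### Zero curvature -/

lemma laxPoly_xCoef (a κ : ℂ) : laxPoly (xCoef a) κ =
    !![Complex.I / 2 * (a * conj a) - Complex.I * κ ^ 2, κ * a;
      -(κ * conj a), -(Complex.I / 2 * (a * conj a) - Complex.I * κ ^ 2)] := by
  rw [Matrix.eta_fin_two (laxPoly _ _)]
  apply mat_ext <;> simp [laxPoly, xCoef, Finset.sum_range_succ] <;> ring

lemma laxPoly_tCoef (a b κ : ℂ) : laxPoly (tCoef a b) κ =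
    !![(a * conj b - b * conj a) / 2 + Complex.I / 4 * (a * conj a) ^ 2
        + Complex.I * κ ^ 2 * (a * conj a) - 2 * Complex.I * κ ^ 4,
      Complex.I * κ * b + 2 * κ ^ 3 * a;
      Complex.I * κ * conj b - 2 * κ ^ 3 * conj a,
      -((a * conj b - b * conj a) / 2 + Complex.I / 4 * (a * conj a) ^ 2
        + Complex.I * κ ^ 2 * (a * conj a) - 2 * Complex.I * κ ^ 4)] := by
  rw [Matrix.eta_fin_two (laxPoly _ _)]
  apply mat_ext <;> simp [laxPoly, tCoef, Finset.sum_range_succ] <;> ring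

/-- Only the upper right entry of the derivative matters for the zero curvature equation. -/
lemma exists_hasMatDeriv_xCoef {a : ℝ → ℂ} {a' : ℂ} {s : ℝ} (ha : HasDerivAt a a' s) (κ : ℂ) :
    ∃ L : Mat, HasMatDeriv (fun s => laxPoly (xCoef (a s)) κ) L s ∧ L 0 1 = κ * a' := by
  have hc : HasDerivAt (fun s => conj (a s)) (conj a') s := ha.star
  refine ⟨Matrix.of fun i j => deriv (fun s => laxPoly (xCoef (a s)) κ i j) s, fun i j => ?_, ?_⟩
  · refine DifferentiableAt.hasDerivAt ?_
    have h1 := ha.differentiableAt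
    have h2 := hc.differentiableAt
    simp only [laxPoly_xCoef]
    fin_cases i <;> fin_cases j <;> simp <;> fun_prop
  · simp only [laxPoly_xCoef]
    exact (ha.const_mul κ).deriv

lemma exists_hasMatDeriv_tCoef {a b : ℝ → ℂ} {a' b' : ℂ} {s : ℝ} (ha : HasDerivAt a a' s)
    (hb : HasDerivAt b b' s) (κ : ℂ) :
    ∃ L : Mat, HasMatDeriv (fun s => laxPoly (tCoef (a s) (b s)) κ) L s ∧
      L 0 1 = Complex.I * κ * b' + 2 * κ ^ 3 * a' := by
  have hc : HasDerivAt (fun s => conj (a s)) (conj a') s := ha.star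
  have hd : HasDerivAt (fun s => conj (b s)) (conj b') s := hb.star
  refine ⟨Matrix.of fun i j => deriv (fun s => laxPoly (tCoef (a s) (b s)) κ i j) s,
    fun i j => ?_, ?_⟩
  · refine DifferentiableAt.hasDerivAt ?_
    have h1 := ha.differentiableAt
    have h2 := hc.differentiableAt
    have h3 := hb.differentiableAt
    have h4 := hd.differentiableAt
    simp only [laxPoly_tCoef]
    fin_cases i <;> fin_cases j <;> simp <;> fun_prop
  · simp only [laxPoly_tCoef]
    exact ((hb.const_mul (Complex.I * κ)).add (ha.const_mul (2 * κ ^ 3))).deriv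

lemma contDiff_slice_x {q : ℝ → ℝ → ℂ} (hq : ContDiff ℝ ∞ (fun p : ℝ × ℝ => q p.1 p.2)) (t : ℝ) :
    ContDiff ℝ ∞ (fun x => q x t) :=
  hq.comp (contDiff_id.prodMk contDiff_const)

lemma contDiff_slice_t {q : ℝ → ℝ → ℂ} (hq : ContDiff ℝ ∞ (fun p : ℝ × ℝ => q p.1 p.2)) (x : ℝ) :
    ContDiff ℝ ∞ (fun t => q x t) :=
  hq.comp (contDiff_const.prodMk contDiff_id)

section eigen

variable {S : Set ℂ} {q : ℝ → ℝ → ℂ} {ψ : ℝ → ℝ → ℂ → Mat}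

/-- A potential whose Lax pair has an invertible eigenfunction on an open set of spectral
parameters solves the equation: the cross derivatives agree, and the upper right entry of the zero
curvature equation at a point `κ ≠ 0` is `κ` times the Gerdjikov-Ivanov expression. -/
theorem IsEigenfunction.isGISolution (h : IsEigenfunction S q ψ) (hS : IsOpen S)
    (hne : S.Nonempty) (hq : ContDiff ℝ ∞ (fun p : ℝ × ℝ => q p.1 p.2)) : IsGISolution q := by
  refine ⟨hq, fun x t => ?_⟩
  obtain ⟨κ, hκ, hκ0⟩ := (dense_compl_singleton (0 : ℂ)).inter_open_nonempty S hS hne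
  have hκ0 : κ ≠ 0 := hκ0
  have dqx : HasDerivAt (fun x' => q x' t) (deriv (fun x' => q x' t) x) x :=
    ((contDiff_slice_x hq t).differentiable (by simp) x).hasDerivAt
  have dqt : HasDerivAt (fun t' => q x t') (deriv (fun t' => q x t') t) t :=
    ((contDiff_slice_t hq x).differentiable (by simp) t).hasDerivAt
  have dqxx : HasDerivAt (fun x' => deriv (fun x'' => q x'' t) x')
      (deriv (fun x' => deriv (fun x'' => q x'' t) x') x) x :=
    (((contDiff_infty_iff_deriv.1 (contDiff_slice_x hq t)).2).differentiable
      (by simp) x).hasDerivAt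
  have dqc : deriv (fun x' => conj (q x' t)) x = conj (deriv (fun x' => q x' t) x) := deriv.star
  obtain ⟨Lt, hLt, hLt01⟩ := exists_hasMatDeriv_xCoef dqt κ
  obtain ⟨Mx, hMx, hMx01⟩ := exists_hasMatDeriv_tCoef dqx dqxx κ
  have A := hLt.mul (h.hasMatDeriv_t hS x t hκ)
  have B := hMx.mul (h.hasMatDeriv_x hS x t hκ)
  set L := laxPoly (xCoef (q x t)) κ with hL
  set M := laxPoly (tCoef (q x t) (deriv (fun x' => q x' t) x)) κ with hM
  have cross : Lt * ψ x t κ + L * (M * ψ x t κ) = Mx * ψ x t κ + M * (L * ψ x t κ) := by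
    ext a b
    have key := hasDerivAt_fderiv_of_symm (g := jointEntry ψ a b) (P := (x, t, κ))
      ((h.contDiffAt hS x t hκ a b).of_le two_le_smooth) (hasDerivAt_curve_x x t κ) rfl
      (hasDerivAt_curve_t x t κ) rfl (Eventually.of_forall fun t' =>
        (h.hasDerivAt_entry_x hS x t' hκ a b).unique (h.hasMatDeriv_x hS x t' hκ a b)) (A a b)
    refine key.unique ?_
    have e : ∀ x', fderiv ℝ (jointEntry ψ a b) (x', t, κ) (0, 1, 0) = _ := fun x' =>
      (h.hasDerivAt_entry_t hS x' t hκ a b).unique (h.hasMatDeriv_t hS x' t hκ a b)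
    simp only [e]
    exact B a b
  have cross' : Lt + L * M = Mx + M * L := by
    have := congrArg (· * (ψ x t (conj κ))ᴴ) cross
    simpa [Matrix.add_mul, Matrix.mul_assoc, h.unitarity x t κ hκ] using this
  have e := congrFun (congrFun cross' 0) 1
  simp only [Matrix.add_apply, Matrix.mul_apply, Fin.sum_univ_two, hLt01, hMx01] at e
  rw [hL, hM, laxPoly_xCoef, laxPoly_tCoef] at e
  simp only [Matrix.of_apply, Matrix.cons_val', Matrix.cons_val_zero, Matrix.cons_val_one,
    Matrix.cons_val_fin_one] at e
  rw [dqc]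
  generalize conj (deriv (fun x' => q x' t) x) = bc at *
  generalize deriv (fun x' => deriv (fun x'' => q x'' t) x') x = qxx at *
  generalize deriv (fun x' => q x' t) x = b at *
  generalize deriv (fun t' => q x t') t = qt at *
  generalize conj (q x t) = ac at *
  generalize q x t = a at *
  apply mul_left_cancel₀ hκ0
  linear_combination Complex.I * e
    + κ * (qxx - Complex.I * a * ac * b + a ^ 3 * ac ^ 2 / 2 + 2 * κ ^ 2 * Complex.I * b)
      * Complex.I_sq

end eigen

/-! ### Smoothness of the residues -/

/-- Smoothness in the variables `x`, `t`. -/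
def SmoothXT (f : ℝ → ℝ → ℂ) : Prop := ContDiff ℝ ∞ (fun P : ℝ × ℝ => f P.1 P.2)

section smooth

variable {f g : ℝ → ℝ → ℂ}

lemma smoothXT_const (a : ℂ) : SmoothXT (fun _ _ => a) := contDiff_const

lemma SmoothXT.add (hf : SmoothXT f) (hg : SmoothXT g) : SmoothXT (fun x t => f x t + g x t) :=
  ContDiff.add hf hg

lemma SmoothXT.sub (hf : SmoothXT f) (hg : SmoothXT g) : SmoothXT (fun x t => f x t - g x t) :=
  ContDiff.sub hf hg

lemma SmoothXT.neg (hf : SmoothXT f) : SmoothXT (fun x t => -f x t) :=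
  ContDiff.neg hf

lemma SmoothXT.mul (hf : SmoothXT f) (hg : SmoothXT g) : SmoothXT (fun x t => f x t * g x t) :=
  ContDiff.mul hf hg

lemma SmoothXT.const_mul (hf : SmoothXT f) (a : ℂ) : SmoothXT (fun x t => a * f x t) :=
  (smoothXT_const a).mul hf

lemma SmoothXT.div (hf : SmoothXT f) (hg : SmoothXT g) (h0 : ∀ x t, g x t ≠ 0) :
    SmoothXT (fun x t => f x t / g x t) := by
  simp only [div_eq_mul_inv]
  exact ContDiff.mul hf (ContDiff.inv hg fun P => h0 P.1 P.2)

lemma SmoothXT.conj (hf : SmoothXT f) : SmoothXT (fun x t => conj (f x t)) :=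
  Complex.conjCLE.contDiff.comp hf

lemma SmoothXT.differentiableAt_x (hf : SmoothXT f) (x t : ℝ) :
    DifferentiableAt ℝ (fun x => f x t) x :=
  (contDiff_slice_x hf t).differentiable (by simp) x

lemma SmoothXT.differentiableAt_t (hf : SmoothXT f) (x t : ℝ) :
    DifferentiableAt ℝ (fun t => f x t) t :=
  (contDiff_slice_t hf x).differentiable (by simp) t

variable {y w : ℝ → ℝ → Vec} {p s : ℂ}

lemma smoothXT_pairing {u v : ℝ → ℝ → Vec} (hu : ∀ i, SmoothXT fun x t => u x t i)
    (hv : ∀ i, SmoothXT fun x t => v x t i) (s : ℂ) :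
    SmoothXT fun x t => pairing s (u x t) (v x t) := by
  simp only [pairing_eq]
  exact (((hu 0).mul (hv 0).conj).const_mul _).add (((hu 1).mul (hv 1).conj).const_mul _)

lemma smoothXT_aCoef {u v : ℝ → ℝ → Vec} (hu : ∀ i, SmoothXT fun x t => u x t i)
    (hv : ∀ i, SmoothXT fun x t => v x t i) (p s : ℂ) :
    SmoothXT fun x t => aCoef p s (u x t) (v x t) :=
  ((smoothXT_pairing hu hv s).const_mul _).add ((smoothXT_pairing hu hv (-s)).const_mul _)

lemma smoothXT_bCoef {u v : ℝ → ℝ → Vec} (hu : ∀ i, SmoothXT fun x t => u x t i)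
    (hv : ∀ i, SmoothXT fun x t => v x t i) (p s : ℂ) :
    SmoothXT fun x t => bCoef p s (u x t) (v x t) :=
  ((smoothXT_pairing hu hv s).const_mul _).add ((smoothXT_pairing hu hv (-s)).const_mul _)

lemma smoothXT_cCoef {u v : ℝ → ℝ → Vec} (hu : ∀ i, SmoothXT fun x t => u x t i)
    (hv : ∀ i, SmoothXT fun x t => v x t i) (p s : ℂ) :
    SmoothXT fun x t => cCoef p s (u x t) (v x t) :=
  ((smoothXT_pairing hu hv s).const_mul _).add ((smoothXT_pairing hu hv (-s)).const_mul _)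

lemma smoothXT_delta (hy : ∀ i, SmoothXT fun x t => y x t i)
    (hw : ∀ i, SmoothXT fun x t => w x t i) (p s : ℂ) :
    SmoothXT fun x t => delta p s (y x t) (w x t) := by
  simp only [delta]
  have ayy := smoothXT_aCoef hy hy p s
  have ayw := smoothXT_aCoef hy hw p s
  have awy := smoothXT_aCoef hw hy p s
  exact (((((awy.mul ayw).sub (ayy.mul (smoothXT_aCoef hw hw p s))).const_mul _).add
    ((ayy.const_mul 2).mul (smoothXT_cCoef hy hy p (-s)))).sub
    ((smoothXT_bCoef hy hy p s).mul (smoothXT_bCoef hy hy p (-s)))).add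
    ((((awy.mul (smoothXT_bCoef hy hy p (-s))).sub (ayw.mul (smoothXT_bCoef hy hy p s))).add
      (ayy.mul ((smoothXT_bCoef hy hw p s).sub (smoothXT_bCoef hw hy p (-s))))).const_mul _)

lemma smoothXT_zVec (hy : ∀ i, SmoothXT fun x t => y x t i)
    (hw : ∀ i, SmoothXT fun x t => w x t i) (hy0 : ∀ x t, y x t ≠ 0) (hg : gap p ≠ 0)
    (i : Fin 2) : SmoothXT fun x t => zVec p (y x t) (w x t) i := by
  have hΔ := smoothXT_delta hy hw p (sgn i)
  have hΔ0 : ∀ x t, delta p (sgn i) (y x t) (w x t) ≠ 0 := fun x t =>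
    delta_ne_zero p (sgn i) _ _ (sgn_eq i) hg (hy0 x t)
  simp only [zVec_apply, lambdaEntry, omegaEntry]
  exact (((((smoothXT_const _).div hΔ hΔ0).neg).mul (smoothXT_aCoef hy hy p _)).mul
    (hw i).conj).add ((((smoothXT_const _).div hΔ hΔ0).mul
      (((smoothXT_aCoef hy hw p _).const_mul _).add (smoothXT_bCoef hy hy p _))).mul (hy i).conj)

lemma smoothXT_zTildeVec (hy : ∀ i, SmoothXT fun x t => y x t i)
    (hw : ∀ i, SmoothXT fun x t => w x t i) (hy0 : ∀ x t, y x t ≠ 0) (hg : gap p ≠ 0)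
    (i : Fin 2) : SmoothXT fun x t => zTildeVec p (y x t) (w x t) i := by
  have hΔ := smoothXT_delta hy hw p (sgn i)
  have hΔ0 : ∀ x t, delta p (sgn i) (y x t) (w x t) ≠ 0 := fun x t =>
    delta_ne_zero p (sgn i) _ _ (sgn_eq i) hg (hy0 x t)
  simp only [zTildeVec_apply, lambdaTildeEntry, omegaTildeEntry]
  exact ((((smoothXT_const _).div hΔ hΔ0).mul (((smoothXT_aCoef hw hy p _).const_mul _).sub
    (smoothXT_bCoef hy hy p _))).mul (hw i).conj).add
    ((((smoothXT_const _).div hΔ hΔ0).mul ((((smoothXT_aCoef hw hw p _).const_mul _).add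
      (((smoothXT_bCoef hy hw p _).sub (smoothXT_bCoef hw hy p _)).const_mul _)).add
      ((smoothXT_cCoef hy hy p _).const_mul 2))).mul (hy i).conj)

lemma smoothXT_bMat (hy : ∀ i, SmoothXT fun x t => y x t i)
    (hw : ∀ i, SmoothXT fun x t => w x t i) (hy0 : ∀ x t, y x t ≠ 0) (hg : gap p ≠ 0)
    (i j : Fin 2) : SmoothXT fun x t => bMat p (y x t) (w x t) i j := by
  simp only [bMat, Matrix.add_apply, Matrix.vecMulVec_apply]
  exact ((smoothXT_zVec hy hw hy0 hg i).mul (hw j)).add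
    ((smoothXT_zTildeVec hy hw hy0 hg i).mul (hy j))

lemma smoothXT_bTildeMat (hy : ∀ i, SmoothXT fun x t => y x t i)
    (hw : ∀ i, SmoothXT fun x t => w x t i) (hy0 : ∀ x t, y x t ≠ 0) (hg : gap p ≠ 0)
    (i j : Fin 2) : SmoothXT fun x t => bTildeMat p (y x t) (w x t) i j := by
  simp only [bTildeMat, Matrix.vecMulVec_apply]
  exact (smoothXT_zVec hy hw hy0 hg i).mul (hy j)

end smooth

section eigen

variable {S : Set ℂ} {q : ℝ → ℝ → ℂ} {ψ : ℝ → ℝ → ℂ → Mat}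

lemma IsEigenfunction.smoothXT (h : IsEigenfunction S q ψ) (hS : IsOpen S) {κ : ℂ} (hκ : κ ∈ S)
    (a b : Fin 2) : SmoothXT fun x t => ψ x t κ a b := by
  refine contDiff_iff_contDiffAt.2 fun P => ?_
  have := (h.contDiffAt hS P.1 P.2 hκ a b).comp (f := fun P : ℝ × ℝ => (P.1, P.2, κ)) P
    (contDiff_fst.prodMk (contDiff_snd.prodMk contDiff_const)).contDiffAt
  exact this

lemma IsEigenfunction.smoothXT_cplxDeriv (h : IsEigenfunction S q ψ) (hS : IsOpen S) {κ : ℂ}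
    (hκ : κ ∈ S) (a b : Fin 2) : SmoothXT fun x t => cplxDeriv (ψ x t) κ a b := by
  refine contDiff_iff_contDiffAt.2 fun P => ?_
  have h1 : ContDiffAt ℝ ∞ (fderiv ℝ (jointEntry ψ a b)) (P.1, P.2, κ) :=
    (h.contDiffAt hS P.1 P.2 hκ a b).fderiv_right (by simp)
  have h2 := (h1.clm_apply (contDiffAt_const (c := ((0, 0, 1) : ℝ × ℝ × ℂ)))).comp
    (f := fun P : ℝ × ℝ => (P.1, P.2, κ)) P
    (contDiff_fst.prodMk (contDiff_snd.prodMk contDiff_const)).contDiffAt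
  refine h2.congr_of_eventuallyEq (Eventually.of_forall fun P => ?_)
  exact h.cplxDeriv_apply hS _ _ hκ a b

lemma IsEigenfunction.smoothXT_yVec (h : IsEigenfunction S q ψ) (hS : IsOpen S)
    (hS' : ∀ κ ∈ S, conj κ ∈ S) {p : ℂ} (hp : p ∈ S) (Υ : Vec) (i : Fin 2) :
    SmoothXT fun x t => yVec p Υ (ψ x t) i := by
  have e : ∀ x t, yVec p Υ (ψ x t) i = conj ((ψ x t (conj p) *ᵥ star Υ) i) := fun x t => by
    rw [← h.star_yVec x t hp, star_vec_apply, Complex.conj_conj]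
  simp only [e, Matrix.mulVec, dotProduct, Fin.sum_univ_two]
  have s := fun a b => h.smoothXT hS (hS' p hp) a b
  exact (((s i 0).mul (smoothXT_const _)).add ((s i 1).mul (smoothXT_const _))).conj

lemma IsEigenfunction.smoothXT_yTildeVec (h : IsEigenfunction S q ψ) (hS : IsOpen S)
    (hS' : ∀ κ ∈ S, conj κ ∈ S) {p : ℂ} (hp : p ∈ S) (Υ Υ' : Vec) (i : Fin 2) :
    SmoothXT fun x t => yTildeVec p Υ Υ' (ψ x t) i := by
  have e : ∀ x t, yTildeVec p Υ Υ' (ψ x t) i = conj ((ψ x t (conj p) *ᵥ star Υ'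
      + cplxDeriv (ψ x t) (conj p) *ᵥ star Υ) i) := fun x t => by
    rw [← h.star_yTildeVec hS hS' x t hp, star_vec_apply, Complex.conj_conj]
  simp only [e, Matrix.mulVec, dotProduct, Fin.sum_univ_two, Pi.add_apply]
  have s := fun a b => h.smoothXT hS (hS' p hp) a b
  have s' := fun a b => h.smoothXT_cplxDeriv hS (hS' p hp) a b
  exact ((((s i 0).mul (smoothXT_const _)).add ((s i 1).mul (smoothXT_const _))).add
    (((s' i 0).mul (smoothXT_const _)).add ((s' i 1).mul (smoothXT_const _)))).conj

end eigen

/-! ### One dressing step -/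

lemma HasMatDeriv.realDeriv_eq {F : ℝ → Mat} {F' : Mat} {x : ℝ} (h : HasMatDeriv F F' x) :
    realDeriv F x = F' :=
  Matrix.ext fun i j => (h i j).deriv

/-- If the residues obey `residue_flow`, the dressing factor intertwines the two Lax flows. -/
lemma dressed_flow {p κ : ℂ} {B B' Ψ : ℝ → Mat} {s : ℝ} {l m : ℕ → Mat}
    (hl : HasParity l) (hm : HasParity m) (h1 : κ - p ≠ 0) (h2 : κ + p ≠ 0)
    (hmatch : Matching p (B s) (B' s) l m)
    (hB : HasMatDeriv B (laxPoly m p * B s + laxPolyDeriv m p * B' s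
      - (B s * laxPoly l p + B' s * laxPolyDeriv l p)) s)
    (hB' : HasMatDeriv B' (laxPoly m p * B' s - B' s * laxPoly l p) s)
    (hΨ : HasMatDeriv Ψ (laxPoly l κ * Ψ s) s) :
    HasMatDeriv (fun s => (1 + polePart p (B s) (B' s) κ) * Ψ s)
      (laxPoly m κ * ((1 + polePart p (B s) (B' s) κ) * Ψ s)) s := by
  have h := ((hasMatDeriv_const 1 s).add (hB.polePart hB' p κ)).mul hΨ
  convert h using 1
  have c := hmatch.commutator hl hm κ h1 h2
  rw [zero_add, sub_eq_add_neg, sub_eq_add_neg, polePart_add, polePart_neg, ← Matrix.mul_assoc,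
    ← Matrix.mul_assoc (1 + _), ← Matrix.add_mul]
  congr 1
  rw [← sub_eq_zero] at c ⊢
  rw [← neg_eq_zero, ← c]
  abel

/-- The points `±p`, `±p̄`. -/
def quartet (p : ℂ) : Set ℂ := {κ | κ = p ∨ κ = -p ∨ κ = conj p ∨ κ = -conj p}

lemma quartet_finite (p : ℂ) : (quartet p).Finite := by
  refine Set.Finite.subset (Set.toFinite {p, -p, conj p, -conj p}) fun κ h => ?_
  simpa [quartet] using h

lemma not_mem_quartet {p κ : ℂ} (h : κ ∉ quartet p) :
    κ - p ≠ 0 ∧ κ + p ≠ 0 ∧ κ - conj p ≠ 0 ∧ κ + conj p ≠ 0 := by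
  simp only [quartet, Set.mem_ofPred_eq, not_or] at h
  obtain ⟨h1, h2, h3, h4⟩ := h
  exact ⟨sub_ne_zero.2 h1, fun e => h2 (eq_neg_of_add_eq_zero_left e), sub_ne_zero.2 h3,
    fun e => h4 (eq_neg_of_add_eq_zero_left e)⟩

lemma conj_mem_quartet {p κ : ℂ} : conj κ ∈ quartet p ↔ κ ∈ quartet p := by
  have e : ∀ a : ℂ, conj κ = a ↔ κ = conj a := fun a =>
    ⟨fun h => by rw [← h, Complex.conj_conj], fun h => by rw [h, Complex.conj_conj]⟩
  simp only [quartet, Set.mem_ofPred_eq, e, map_neg, Complex.conj_conj]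
  tauto

lemma sigma3_mul_self : sigma3 * sigma3 = 1 := by
  ext i j
  fin_cases i <;> fin_cases j <;> simp [sigma3]

lemma stepFactor_apply (p : ℂ) (Υ Υ' : Vec) (Ψ : ℂ → Mat) (κ : ℂ) (i j : Fin 2) :
    stepFactor p Υ Υ' Ψ κ i j = (1 : Mat) i j + scalarPole p (sgn i * sgn j)
      (bMat p (yVec p Υ Ψ) (yTildeVec p Υ Υ' Ψ) i j)
      (bTildeMat p (yVec p Υ Ψ) (yTildeVec p Υ Υ' Ψ) i j) κ := by
  rw [stepFactor, Matrix.add_apply, polePart_apply]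

lemma stepFactor_conjTranspose (p : ℂ) (Υ Υ' : Vec) (Ψ : ℂ → Mat) (κ : ℂ) :
    (stepFactor p Υ Υ' Ψ (conj κ))ᴴ = stepFactorInv p Υ Υ' Ψ κ := by
  rw [stepFactor, stepFactorInv, Matrix.conjTranspose_add, Matrix.conjTranspose_one,
    polePart_conjTranspose, Complex.conj_conj]

lemma contDiffOn_scalarPole {T : Set ℂ} {b b' : ℝ → ℝ → ℂ} (hb : SmoothXT b) (hb' : SmoothXT b')
    (p s : ℂ) (h1 : ∀ κ ∈ T, κ - p ≠ 0) (h2 : ∀ κ ∈ T, κ + p ≠ 0) :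
    ContDiffOn ℝ ∞ (fun P : ℝ × ℝ × ℂ => scalarPole p s (b P.1 P.2.1) (b' P.1 P.2.1) P.2.2)
      (Set.univ ×ˢ Set.univ ×ˢ T) := by
  have c1 : ContDiff ℝ ∞ fun P : ℝ × ℝ × ℂ => b P.1 P.2.1 :=
    ContDiff.comp hb (contDiff_fst.prodMk (contDiff_fst.comp contDiff_snd))
  have c2 : ContDiff ℝ ∞ fun P : ℝ × ℝ × ℂ => b' P.1 P.2.1 :=
    ContDiff.comp hb' (contDiff_fst.prodMk (contDiff_fst.comp contDiff_snd))
  have c3 : ContDiff ℝ ∞ fun P : ℝ × ℝ × ℂ => P.2.2 := contDiff_snd.comp contDiff_snd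
  have i1 : ContDiffOn ℝ ∞ (fun P : ℝ × ℝ × ℂ => (P.2.2 - p)⁻¹) (Set.univ ×ˢ Set.univ ×ˢ T) :=
    (c3.sub contDiff_const).contDiffOn.inv fun P hP => h1 _ hP.2.2
  have i2 : ContDiffOn ℝ ∞ (fun P : ℝ × ℝ × ℂ => (P.2.2 + p)⁻¹) (Set.univ ×ˢ Set.univ ×ˢ T) :=
    (c3.add contDiff_const).contDiffOn.inv fun P hP => h2 _ hP.2.2
  simp only [scalarPole_eq_inv]
  exact (((c1.contDiffOn.mul i1).sub ((contDiff_const.mul c1).contDiffOn.mul i2)).add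
    (c2.contDiffOn.mul (i1.pow 2))).add ((contDiff_const.mul c2).contDiffOn.mul (i2.pow 2))

section step

variable {S : Set ℂ} {q : ℝ → ℝ → ℂ} {ψ : ℝ → ℝ → ℂ → Mat} {p : ℂ} {Υ : Vec} (Υ' : Vec)

/-- The residue `B` of one dressing step. -/
def residue (p : ℂ) (Υ Υ' : Vec) (Ψ : ℂ → Mat) : Mat :=
  bMat p (yVec p Υ Ψ) (yTildeVec p Υ Υ' Ψ)

/-- The second-order coefficient `B̃` of one dressing step. -/
def residueTilde (p : ℂ) (Υ Υ' : Vec) (Ψ : ℂ → Mat) : Mat :=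
  bTildeMat p (yVec p Υ Ψ) (yTildeVec p Υ Υ' Ψ)

/-- The dressed potential `q + 4 i B₁₂`. -/
def dressedPotential (p : ℂ) (Υ Υ' : Vec) (q : ℝ → ℝ → ℂ) (ψ : ℝ → ℝ → ℂ → Mat) (x t : ℝ) : ℂ :=
  q x t + 4 * Complex.I * residue p Υ Υ' (ψ x t) 0 1

lemma stepFactor_eq (p : ℂ) (Υ Υ' : Vec) (Ψ : ℂ → Mat) (κ : ℂ) :
    stepFactor p Υ Υ' Ψ κ = 1 + polePart p (residue p Υ Υ' Ψ) (residueTilde p Υ Υ' Ψ) κ := rfl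

lemma IsEigenfunction.stepFactor_mul_inv (h : IsEigenfunction S q ψ) (hp : p ∈ S)
    (hg : gap p ≠ 0) (hΥ : Υ ≠ 0) (x t : ℝ) {κ : ℂ} (hκ : κ ∉ quartet p) :
    stepFactor p Υ Υ' (ψ x t) κ * stepFactorInv p Υ Υ' (ψ x t) κ = 1 := by
  obtain ⟨h1, h2, h3, h4⟩ := not_mem_quartet hκ
  exact dressing_mul_inverse p _ _ κ (h.yVec_ne_zero x t hp hΥ) hg h1 h2 h3 h4

lemma IsEigenfunction.smoothXT_residue (h : IsEigenfunction S q ψ) (hS : IsOpen S)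
    (hS' : ∀ κ ∈ S, conj κ ∈ S) (hp : p ∈ S) (hg : gap p ≠ 0) (hΥ : Υ ≠ 0) (i j : Fin 2) :
    SmoothXT (fun x t => residue p Υ Υ' (ψ x t) i j) ∧
    SmoothXT (fun x t => residueTilde p Υ Υ' (ψ x t) i j) :=
  ⟨smoothXT_bMat (h.smoothXT_yVec hS hS' hp Υ) (h.smoothXT_yTildeVec hS hS' hp Υ Υ')
    (fun x t => h.yVec_ne_zero x t hp hΥ) hg i j,
  smoothXT_bTildeMat (h.smoothXT_yVec hS hS' hp Υ) (h.smoothXT_yTildeVec hS hS' hp Υ Υ')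
    (fun x t => h.yVec_ne_zero x t hp hΥ) hg i j⟩

/-- The flow of the residues along a curve in the `(x, t)` plane on which `ψ` obeys a Lax
equation. -/
lemma IsEigenfunction.residue_flow (h : IsEigenfunction S q ψ) (hS : IsOpen S)
    (hS' : ∀ κ ∈ S, conj κ ∈ S) (hp : p ∈ S) (hg : gap p ≠ 0) (hΥ : Υ ≠ 0) (x t : ℝ)
    {c : ℝ → ℝ × ℝ} {v : ℝ × ℝ × ℂ} {s : ℝ} (hs : c s = (x, t))
    (hc : ∀ κ, HasDerivAt (fun s => ((c s).1, (c s).2, κ)) v s) {l m : ℕ → Mat}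
    (hl : HasParity l) (hm : HasParity m) (hskew : ∀ n, (l n)ᴴ = -l n)
    (hψ : ∀ κ ∈ S, HasMatDeriv (fun s => ψ (c s).1 (c s).2 κ) (laxPoly l κ * ψ x t κ) s)
    (hmatch : Matching p (residue p Υ Υ' (ψ x t)) (residueTilde p Υ Υ' (ψ x t)) l m) :
    HasMatDeriv (fun s => residue p Υ Υ' (ψ (c s).1 (c s).2))
      (laxPoly m p * residue p Υ Υ' (ψ x t) + laxPolyDeriv m p * residueTilde p Υ Υ' (ψ x t)
      - (residue p Υ Υ' (ψ x t) * laxPoly l p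
        + residueTilde p Υ Υ' (ψ x t) * laxPolyDeriv l p)) s ∧
    HasMatDeriv (fun s => residueTilde p Υ Υ' (ψ (c s).1 (c s).2))
      (laxPoly m p * residueTilde p Υ Υ' (ψ x t) - residueTilde p Υ Υ' (ψ x t) * laxPoly l p) s := by
  obtain ⟨dy, dw⟩ := h.hasVecDeriv_yVec hS hS' x t hp Υ Υ' hs hc hskew hψ
  have y0 : ∀ x t, yVec p Υ (ψ x t) ≠ 0 := fun x t => h.yVec_ne_zero x t hp hΥ
  -- differentiability along the curve
  have hcurve : DifferentiableAt ℝ c s := by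
    have h0 := (hc 0).differentiableAt
    have h1 : DifferentiableAt ℝ (fun s => (c s).1) s := h0.fst
    have h2 : DifferentiableAt ℝ (fun s => (c s).2) s := h0.snd.fst
    exact h1.prodMk h2
  have along : ∀ {f : ℝ → ℝ → ℂ}, SmoothXT f →
      DifferentiableAt ℝ (fun s => f (c s).1 (c s).2) s := fun {f} hf => by
    have hf' : DifferentiableAt ℝ (fun P : ℝ × ℝ => f P.1 P.2) (c s) :=
      ContDiff.differentiable hf (by simp) _
    exact hf'.comp s hcurve
  have sy := h.smoothXT_yVec hS hS' hp Υ
  have sw := h.smoothXT_yTildeVec hS hS' hp Υ Υ'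
  have dz : HasVecDeriv (fun s => zVec p (yVec p Υ (ψ (c s).1 (c s).2))
      (yTildeVec p Υ Υ' (ψ (c s).1 (c s).2))) _ s := fun i =>
    (along (smoothXT_zVec sy sw y0 hg i)).hasDerivAt
  have dz' : HasVecDeriv (fun s => zTildeVec p (yVec p Υ (ψ (c s).1 (c s).2))
      (yTildeVec p Υ Υ' (ψ (c s).1 (c s).2))) _ s := fun i =>
    (along (smoothXT_zTildeVec sy sw y0 hg i)).hasDerivAt
  have key := GerdjikovIvanov.residue_flow (p := p)
    (y := fun s => yVec p Υ (ψ (c s).1 (c s).2))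
    (w := fun s => yTildeVec p Υ Υ' (ψ (c s).1 (c s).2)) (l := l) (m := m) (x := s) hg
    (y0 _ _) hl hm hskew (by simpa only [hs] using dy) (by simpa only [hs] using dw) dz dz'
    (fun s => (jetPole_zVec p _ _ (y0 _ _) hg).1)
    (fun s => (jetPole_zVec p _ _ (y0 _ _) hg).2)
    (B := fun s => residue p Υ Υ' (ψ (c s).1 (c s).2))
    (B' := fun s => residueTilde p Υ Υ' (ψ (c s).1 (c s).2))
    (fun _ => rfl) (fun _ => rfl) (by simpa only [hs] using hmatch)
  simpa only [hs] using key

/-- One dressing step turns an eigenfunction for `q` into one for `q + 4 i B₁₂`, away from the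
new poles. -/
theorem IsEigenfunction.dress (h : IsEigenfunction S q ψ) (hS : IsOpen S)
    (hS' : ∀ κ ∈ S, conj κ ∈ S) (hq : SmoothXT q) (hp : p ∈ S) (hg : gap p ≠ 0) (hΥ : Υ ≠ 0) :
    IsEigenfunction (S \ quartet p) (dressedPotential p Υ Υ' q ψ)
      (fun x t κ => stepFactor p Υ Υ' (ψ x t) κ * ψ x t κ) := by
  have mat_x : ∀ x t, Matching p (residue p Υ Υ' (ψ x t)) (residueTilde p Υ Υ' (ψ x t))
      (xCoef (q x t)) (xCoef (dressedPotential p Υ Υ' q ψ x t)) := fun x t =>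
    matching_x p _ _ _ _ (bMat_one_zero p _ _ (h.yVec_ne_zero x t hp hΥ) hg) rfl
  have flow_x := fun x t => h.residue_flow Υ' hS hS' hp hg hΥ x t (c := fun x' => (x', t))
    rfl (hasDerivAt_curve_x x t) (xCoef_hasParity _) (xCoef_hasParity _) (xCoef_skew _)
    (fun κ hκ => h.hasMatDeriv_x hS x t hκ) (mat_x x t)
  have mat_t : ∀ x t, Matching p (residue p Υ Υ' (ψ x t)) (residueTilde p Υ Υ' (ψ x t))
      (tCoef (q x t) (deriv (fun x' => q x' t) x))
      (tCoef (dressedPotential p Υ Υ' q ψ x t)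
        (deriv (fun x' => dressedPotential p Υ Υ' q ψ x' t) x)) := fun x t => by
    have anti : ∀ x, residue p Υ Υ' (ψ x t) 1 0 = -conj (residue p Υ Υ' (ψ x t) 0 1) :=
      fun x => bMat_one_zero p _ _ (h.yVec_ne_zero x t hp hΥ) hg
    refine matching_t p _ _ _ _ _ _ (anti x) rfl rfl ?_ ?_
    · have d := ((flow_x x t).1 1 0)
      simp only [anti] at d
      exact d.unique (((flow_x x t).1 0 1).star.neg)
    · exact ((hq.differentiableAt_x x t).hasDerivAt.add
        (((flow_x x t).1 0 1).const_mul _)).deriv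
  have flow_t := fun x t => h.residue_flow Υ' hS hS' hp hg hΥ x t (c := fun t' => (x, t'))
    rfl (hasDerivAt_curve_t x t) (tCoef_hasParity _ _) (tCoef_hasParity _ _) (tCoef_skew _ _)
    (fun κ hκ => h.hasMatDeriv_t hS x t hκ) (mat_t x t)
  have sres := fun i j => h.smoothXT_residue Υ' hS hS' hp hg hΥ i j
  constructor
  · intro a b
    simp only [Matrix.mul_apply, Fin.sum_univ_two]
    have c : ∀ i j, ContDiffOn ℝ ∞ (fun P : ℝ × ℝ × ℂ =>
        stepFactor p Υ Υ' (ψ P.1 P.2.1) P.2.2 i j) (Set.univ ×ˢ Set.univ ×ˢ (S \ quartet p)) :=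
      fun i j => by
        simp only [stepFactor_apply]
        exact contDiffOn_const.add (contDiffOn_scalarPole (sres i j).1 (sres i j).2 p _
          (fun κ hκ => (not_mem_quartet hκ.2).1) (fun κ hκ => (not_mem_quartet hκ.2).2.1))
    have d : ∀ i j, ContDiffOn ℝ ∞ (fun P : ℝ × ℝ × ℂ => ψ P.1 P.2.1 P.2.2 i j)
        (Set.univ ×ˢ Set.univ ×ˢ (S \ quartet p)) := fun i j =>
      (h.smooth i j).mono (Set.prod_mono le_rfl (Set.prod_mono le_rfl Set.sdiff_subset))
    exact ((c a 0).mul (d 0 b)).add ((c a 1).mul (d 1 b))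
  · intro x t a b κ hκ
    obtain ⟨h1, h2, -, -⟩ := not_mem_quartet hκ.2
    have d1 : HasMatDeriv (stepFactor p Υ Υ' (ψ x t)) _ κ :=
      (hasMatDeriv_const 1 κ).add (hasMatDeriv_polePart p _ _ κ h1 h2)
    have d2 := (d1.mul (h.hasMatDeriv_spectral hS x t hκ.1)) a b
    exact d2.differentiableAt.differentiableWithinAt
  · intro x t κ hκ
    obtain ⟨h1, h2, -, -⟩ := not_mem_quartet hκ.2
    have d := dressed_flow (B := fun x' => residue p Υ Υ' (ψ x' t))
      (B' := fun x' => residueTilde p Υ Υ' (ψ x' t)) (Ψ := fun x' => ψ x' t κ) (xCoef_hasParity _) (xCoef_hasParity _) h1 h2 (mat_x x t)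
      (flow_x x t).1 (flow_x x t).2 (h.hasMatDeriv_x hS x t hκ.1)
    simp only [stepFactor_eq]
    rw [d.realDeriv_eq, ← laxU_eq, Matrix.sub_mul, Matrix.smul_mul]
    abel
  · intro x t κ hκ
    obtain ⟨h1, h2, -, -⟩ := not_mem_quartet hκ.2
    have d := dressed_flow (B := fun t' => residue p Υ Υ' (ψ x t'))
      (B' := fun t' => residueTilde p Υ Υ' (ψ x t')) (Ψ := fun t' => ψ x t' κ) (tCoef_hasParity _ _) (tCoef_hasParity _ _) h1 h2 (mat_t x t)
      (flow_t x t).1 (flow_t x t).2 (h.hasMatDeriv_t hS x t hκ.1)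
    simp only [stepFactor_eq]
    rw [d.realDeriv_eq, ← laxV_eq, Matrix.sub_mul, Matrix.smul_mul]
    abel
  · intro x t κ hκ
    have e : sigma3 * stepFactor p Υ Υ' (ψ x t) (-κ) * sigma3 = stepFactor p Υ Υ' (ψ x t) κ := by
      rw [stepFactor_eq, stepFactor_eq, Matrix.mul_add, Matrix.add_mul, polePart_parity,
        Matrix.mul_one, sigma3_mul_self]
    calc _ = sigma3 * stepFactor p Υ Υ' (ψ x t) (-κ) * (sigma3 * sigma3) * ψ x t (-κ) * sigma3 := by
          rw [sigma3_mul_self]; simp only [Matrix.mul_assoc, Matrix.one_mul]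
      _ = (sigma3 * stepFactor p Υ Υ' (ψ x t) (-κ) * sigma3) * (sigma3 * ψ x t (-κ) * sigma3) := by
          simp only [Matrix.mul_assoc]
      _ = _ := by rw [e, h.parity x t κ hκ.1]
  · intro x t κ hκ
    rw [Matrix.conjTranspose_mul, stepFactor_conjTranspose, Matrix.mul_assoc,
      ← Matrix.mul_assoc (ψ x t κ), h.unitarity x t κ hκ.1, Matrix.one_mul,
      h.stepFactor_mul_inv Υ' hp hg hΥ x t hκ.2]

end step

/-! ### The iterated dressing -/

lemma poleSet_zero (k : ℕ → ℂ) : poleSet k 0 = ∅ := by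
  ext κ
  simp [poleSet]

lemma mem_poleSet {k : ℕ → ℂ} {N : ℕ} {κ : ℂ} :
    κ ∈ poleSet k N ↔ ∃ j < N, κ ∈ quartet (k j) := Iff.rfl

lemma poleSet_succ (k : ℕ → ℂ) (j : ℕ) : poleSet k (j + 1) = poleSet k j ∪ quartet (k j) := by
  ext κ
  simp only [Set.mem_union, mem_poleSet, Nat.lt_succ_iff_lt_or_eq, or_and_right, exists_or,
    exists_eq_left]

lemma poleSet_finite (k : ℕ → ℂ) (N : ℕ) : (poleSet k N).Finite := by
  induction N with
  | zero => simp [poleSet_zero]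
  | succ j ih => rw [poleSet_succ]; exact ih.union (quartet_finite _)

lemma sq_eq_of_mem_quartet {p κ : ℂ} (h : κ ∈ quartet p) :
    κ ^ 2 = p ^ 2 ∨ κ ^ 2 = (conj p) ^ 2 := by
  rcases h with h | h | h | h <;> simp [h]

/-- The potential after `j` dressing steps. -/
def iteratedPotential (k : ℕ → ℂ) (Υ Υ' : ℕ → Vec) (q₀ : ℝ → ℝ → ℂ) (ψ₀ : ℝ → ℝ → ℂ → Mat)
    (j : ℕ) (x t : ℝ) : ℂ :=
  q₀ x t + 4 * Complex.I * ∑ i ∈ Finset.range j,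
    residue (k i) (Υ i) (Υ' i) (dressed k Υ Υ' (ψ₀ x t) i) 0 1

/-- Every dressing step yields an eigenfunction, on the complement of the poles used so far, and a
solution. -/
theorem dressed_isEigenfunction {N : ℕ} {k : ℕ → ℂ} {Υ Υ' : ℕ → Vec}
    (hk : ∀ j < N, gap (k j) ≠ 0)
    (hk_ne : ∀ i < N, ∀ j < N, i ≠ j → (k i) ^ 2 ≠ (k j) ^ 2 ∧ (k i) ^ 2 ≠ (conj (k j)) ^ 2)
    (hΥ : ∀ j < N, Υ j ≠ 0) {S : Set ℂ} (hS : IsOpen S) (hS_conj : ∀ κ ∈ S, conj κ ∈ S)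
    (hkS : ∀ j < N, k j ∈ S) {q₀ : ℝ → ℝ → ℂ} (hq₀ : IsGISolution q₀)
    {ψ₀ : ℝ → ℝ → ℂ → Mat} (hψ₀ : IsEigenfunction S q₀ ψ₀) (j : ℕ) (hj : j ≤ N) :
    IsEigenfunction (S \ poleSet k j) (iteratedPotential k Υ Υ' q₀ ψ₀ j)
      (fun x t => dressed k Υ Υ' (ψ₀ x t) j) ∧
    IsGISolution (iteratedPotential k Υ Υ' q₀ ψ₀ j) ∧
    IsOpen (S \ poleSet k j) ∧ (∀ κ ∈ S \ poleSet k j, conj κ ∈ S \ poleSet k j) ∧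
    (∀ i < N, j ≤ i → k i ∈ S \ poleSet k j) := by
  induction j with
  | zero =>
    have e : iteratedPotential k Υ Υ' q₀ ψ₀ 0 = q₀ := by
      funext x t
      simp [iteratedPotential]
    rw [poleSet_zero, Set.sdiff_empty, e]
    exact ⟨hψ₀, hq₀, hS, hS_conj, fun i hi _ => hkS i hi⟩
  | succ j ih =>
    obtain ⟨h, hq, hopen, hconj, hmem⟩ := ih (by omega)
    have hjN : j < N := hj
    have hp := hmem j hjN le_rfl
    have e : iteratedPotential k Υ Υ' q₀ ψ₀ (j + 1) = dressedPotential (k j) (Υ j) (Υ' j)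
        (iteratedPotential k Υ Υ' q₀ ψ₀ j) (fun x t => dressed k Υ Υ' (ψ₀ x t) j) := by
      funext x t
      simp only [iteratedPotential, dressedPotential, Finset.sum_range_succ]
      ring
    have step := h.dress (Υ' j) hopen hconj hq.smooth hp (hk j hjN) (hΥ j hjN)
    rw [← e] at step
    have eS : S \ poleSet k (j + 1) = (S \ poleSet k j) \ quartet (k j) := by
      rw [poleSet_succ, Set.sdiff_sdiff]
    have hopen' : IsOpen ((S \ poleSet k j) \ quartet (k j)) :=
      hopen.sdiff (quartet_finite _).isClosed
    have hne : ((S \ poleSet k j) \ quartet (k j)).Nonempty :=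
      (dense_univ.sdiff_finite (quartet_finite (k j))).inter_open_nonempty _ hopen ⟨_, hp⟩ |>.mono
        fun κ hκ => ⟨hκ.1, hκ.2.2⟩
    have smooth : SmoothXT (iteratedPotential k Υ Υ' q₀ ψ₀ (j + 1)) := by
      rw [e]
      exact SmoothXT.add hq.smooth
        ((h.smoothXT_residue (Υ' j) hopen hconj hp (hk j hjN) (hΥ j hjN) 0 1).1.const_mul _)
    rw [eS]
    refine ⟨step, step.isGISolution hopen' hne smooth, hopen', fun κ hκ =>
      ⟨hconj κ hκ.1, fun h => hκ.2 (conj_mem_quartet.1 h)⟩, fun i hi hij =>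
      ⟨hmem i hi (by omega), fun hm => ?_⟩⟩
    have := hk_ne i hi j hjN (by omega)
    rcases sq_eq_of_mem_quartet hm with h | h
    · exact this.1 h
    · exact this.2 h

/-! ### Partial fractions of the product -/

/-- The partial fractions of the product of the dressing factors. The sum of the upper right entries
of the residues grows by `B₁₂` in each step, because the residues of the mixed products cancel. -/
lemma dressingProduct_expansion {N : ℕ} {k : ℕ → ℂ} (Υ Υ' : ℕ → Vec) (Ψ : ℂ → Mat)
    (hk_ne : ∀ i < N, ∀ j < N, i ≠ j → (k i) ^ 2 ≠ (k j) ^ 2) (j : ℕ) (hj : j ≤ N) :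
    ∃ A A' : ℕ → Mat,
      (∀ κ ∉ poleSet k j, dressingProduct k Υ Υ' Ψ j κ =
        1 + ∑ i ∈ Finset.range j, polePart (k i) (A i) (A' i) κ) ∧
      ∑ i ∈ Finset.range j, A i 0 1 =
        ∑ i ∈ Finset.range j, residue (k i) (Υ i) (Υ' i) (dressed k Υ Υ' Ψ i) 0 1 := by
  induction j with
  | zero => exact ⟨0, 0, fun κ _ => by simp [dressingProduct], by simp⟩
  | succ j ih =>
    obtain ⟨A, A', hA, hsum⟩ := ih (by omega)
    set p := k j with hp
    set B := residue p (Υ j) (Υ' j) (dressed k Υ Υ' Ψ j) with hB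
    set B' := residueTilde p (Υ j) (Υ' j) (dressed k Υ Υ' Ψ j) with hB'
    -- the residues of the products of the new pole part with the old ones
    set C : ℕ → Mat := fun i => B * polePart (k i) (A i) (A' i) p
      + B' * polePartDeriv (k i) (A i) (A' i) p with hC
    set C' : ℕ → Mat := fun i => B' * polePart (k i) (A i) (A' i) p with hC'
    set E : ℕ → Mat := fun i => polePart p B B' (k i) * A i
      + polePartDeriv p B B' (k i) * A' i with hE
    set E' : ℕ → Mat := fun i => polePart p B B' (k i) * A' i with hE'
    refine ⟨fun i => if i = j then B + ∑ i ∈ Finset.range j, C i else A i + E i,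
      fun i => if i = j then B' + ∑ i ∈ Finset.range j, C' i else A' i + E' i, ?_, ?_⟩
    · intro κ hκ
      rw [poleSet_succ, Set.mem_union, not_or] at hκ
      obtain ⟨k1, k2, -, -⟩ := not_mem_quartet hκ.2
      have prod : ∀ i ∈ Finset.range j, polePart p B B' κ * polePart (k i) (A i) (A' i) κ =
          polePart p (C i) (C' i) κ + polePart (k i) (E i) (E' i) κ := by
        intro i hi
        have hi' := Finset.mem_range.1 hi
        obtain ⟨k3, k4, -, -⟩ := not_mem_quartet (p := k i) fun h => hκ.1 ⟨i, hi', h⟩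
        have hne := hk_ne i (by omega) j (by omega) (by omega)
        refine polePart_mul_polePart p (k i) B B' (A i) (A' i) κ k1 k2 k3 k4 ?_ ?_
        · intro h
          exact hne (by rw [← sub_eq_zero.1 h])
        · intro h
          exact hne (by rw [← hp, eq_neg_of_add_eq_zero_left h]; ring)
      simp only [dressingProduct]
      rw [hA κ hκ.1, stepFactor_eq, Finset.sum_range_succ, if_pos rfl, if_pos rfl,
        polePart_add, ← polePart_sum]
      have old : ∀ i ∈ Finset.range j,
          polePart (k i) (if i = j then B + ∑ i ∈ Finset.range j, C i else A i + E i)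
            (if i = j then B' + ∑ i ∈ Finset.range j, C' i else A' i + E' i) κ =
          polePart (k i) (A i) (A' i) κ + polePart (k i) (E i) (E' i) κ := fun i hi => by
        have : i ≠ j := (Finset.mem_range.1 hi).ne
        rw [if_neg this, if_neg this, polePart_add]
      rw [Finset.sum_congr rfl old, Matrix.mul_add, Matrix.mul_one, Matrix.add_mul, Matrix.one_mul,
        Finset.mul_sum, Finset.sum_congr rfl prod, Finset.sum_add_distrib, Finset.sum_add_distrib]
      abel
    · have old : ∀ i ∈ Finset.range j,
          (if i = j then B + ∑ i ∈ Finset.range j, C i else A i + E i) 0 1 =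
          A i 0 1 + E i 0 1 := fun i hi => by
        have : i ≠ j := (Finset.mem_range.1 hi).ne
        rw [if_neg this, Matrix.add_apply]
      have cancel : ∑ i ∈ Finset.range j, C i 0 1 + ∑ i ∈ Finset.range j, E i 0 1 = 0 := by
        rw [← Finset.sum_add_distrib]
        exact Finset.sum_eq_zero fun i _ =>
          polePart_residue_sum p (k i) B B' (A i) (A' i) 0 1 (by simp)
      beta_reduce
      rw [Finset.sum_range_succ, Finset.sum_range_succ, Finset.sum_congr rfl old, if_pos rfl,
        Finset.sum_add_distrib, hsum, Matrix.add_apply, Matrix.sum_apply]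
      linear_combination cancel

/-! ### Analyticity at the poles -/

lemma analyticAt_laxPoly (l : ℕ → Mat) (p : ℂ) (a b : Fin 2) :
    AnalyticAt ℂ (fun κ => laxPoly l κ a b) p :=
  Differentiable.analyticAt (fun κ => (hasMatDeriv_laxPoly l κ a b).differentiableAt) p

/-- If `Ψ` obeys a Lax equation near a pole, then the logarithmic derivative has a removable
singularity there: it is the Lax polynomial. -/
lemma analyticAfterRemoval_of_lax {S P : Set ℂ} (hS : IsOpen S) (hP : P.Finite) {p : ℂ}
    (hp : p ∈ S) {F G : ℂ → Mat} (l : ℕ → Mat) (hG : ∀ κ ∈ S \ P, IsUnit (G κ))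
    (hF : ∀ κ ∈ S \ P, F κ = laxPoly l κ * G κ) :
    AnalyticAfterRemoval (fun κ => F κ * (G κ)⁻¹) p := by
  refine ⟨laxPoly l, analyticAt_laxPoly l p, ?_⟩
  have h1 : ∀ᶠ κ in 𝓝[≠] p, κ ∈ S := eventually_nhdsWithin_of_eventually_nhds (hS.mem_nhds hp)
  have h2 : ∀ᶠ κ in 𝓝[≠] p, κ ∉ P \ {p} :=
    eventually_nhdsWithin_of_eventually_nhds
      ((hP.subset Set.sdiff_subset).isClosed.isOpen_compl.mem_nhds (by simp))
  filter_upwards [h1, h2, self_mem_nhdsWithin] with κ k1 k2 k3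
  have hκ : κ ∈ S \ P := ⟨k1, fun h => k2 ⟨h, k3⟩⟩
  rw [hF κ hκ, Matrix.mul_assoc, Matrix.mul_nonsing_inv _ ((Matrix.isUnit_iff_isUnit_det _).1
    (hG κ hκ)), Matrix.mul_one]

lemma mem_of_mem_poleSet {k : ℕ → ℂ} {N : ℕ} {S : Set ℂ} (hS_neg : ∀ κ ∈ S, -κ ∈ S)
    (hS_conj : ∀ κ ∈ S, conj κ ∈ S) (hkS : ∀ j < N, k j ∈ S) {p : ℂ} (hp : p ∈ poleSet k N) :
    p ∈ S := by
  obtain ⟨j, hj, rfl | rfl | rfl | rfl⟩ := hp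
  · exact hkS j hj
  · exact hS_neg _ (hkS j hj)
  · exact hS_conj _ (hkS j hj)
  · exact hS_neg _ (hS_conj _ (hkS j hj))

end GerdjikovIvanov

end

open GerdjikovIvanov
theorem proposition2 (N : ℕ) (k : ℕ → ℂ) (Υ Υ' : ℕ → Vec)
    -- no pole is real or purely imaginary
    (hk : ∀ j < N, (k j) ^ 2 ≠ (starRingEnd ℂ (k j)) ^ 2)
    -- the points of different steps are distinct
    (hk_ne : ∀ i < N, ∀ j < N, i ≠ j →
      (k i) ^ 2 ≠ (k j) ^ 2 ∧ (k i) ^ 2 ≠ (starRingEnd ℂ (k j)) ^ 2)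
    (hΥ : ∀ j < N, Υ j ≠ 0)
    -- the domain of the spectral parameter
    (S : Set ℂ) (hS : IsOpen S) (hS_neg : ∀ κ ∈ S, -κ ∈ S)
    (hS_conj : ∀ κ ∈ S, starRingEnd ℂ κ ∈ S) (hkS : ∀ j < N, k j ∈ S)
    -- the seed solution and its eigenfunction
    (q₀ : ℝ → ℝ → ℂ) (hq₀ : IsGISolution q₀)
    (ψ₀ : ℝ → ℝ → ℂ → Mat) (hψ₀ : IsEigenfunction S q₀ ψ₀) :
    -- the construction is well defined, with the stated inverse of each factor
    (∀ j < N, ∀ x t : ℝ,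
      (∀ s : ℂ, s = 1 ∨ s = -1 →
        delta (k j) s (yVec (k j) (Υ j) (dressed k Υ Υ' (ψ₀ x t) j))
          (yTildeVec (k j) (Υ j) (Υ' j) (dressed k Υ Υ' (ψ₀ x t) j)) ≠ 0) ∧
      ∀ κ : ℂ, κ ∉ poleSet k N →
        stepFactor (k j) (Υ j) (Υ' j) (dressed k Υ Υ' (ψ₀ x t) j) κ *
          stepFactorInv (k j) (Υ j) (Υ' j) (dressed k Υ Υ' (ψ₀ x t) j) κ = 1) ∧
    -- away from the poles, `ψ = ψ_N` is invertible and differentiable in `x` and in `t`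
    (∀ x t : ℝ, ∀ κ ∈ S, κ ∉ poleSet k N →
      IsUnit (dressed k Υ Υ' (ψ₀ x t) N κ) ∧
      ∀ a b : Fin 2,
        DifferentiableAt ℝ (fun x' => dressed k Υ Υ' (ψ₀ x' t) N κ a b) x ∧
        DifferentiableAt ℝ (fun t' => dressed k Υ Υ' (ψ₀ x t') N κ a b) t) ∧
    -- `ψ_x ψ⁻¹` and `ψ_t ψ⁻¹` are analytic at all the points `±k_j`, `±k̄_j`
    (∀ x t : ℝ, ∀ p ∈ poleSet k N,
      AnalyticAfterRemoval (fun κ =>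
        realDeriv (fun x' => dressed k Υ Υ' (ψ₀ x' t) N κ) x *
          (dressed k Υ Υ' (ψ₀ x t) N κ)⁻¹) p ∧
      AnalyticAfterRemoval (fun κ =>
        realDeriv (fun t' => dressed k Υ Υ' (ψ₀ x t') N κ) t *
          (dressed k Υ Υ' (ψ₀ x t) N κ)⁻¹) p) ∧
    -- the partial fractions of `D_N ⋯ D_1` and the resulting solution
    (∃ A A' : ℕ → ℝ → ℝ → Mat,
      (∀ x t : ℝ, ∀ κ : ℂ, κ ∉ poleSet k N →
        dressingProduct k Υ Υ' (ψ₀ x t) N κ =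
          1 + ∑ j ∈ Finset.range N, polePart (k j) (A j x t) (A' j x t) κ) ∧
      IsGISolution (fun x t =>
        q₀ x t + 4 * Complex.I * ∑ j ∈ Finset.range N, A j x t 0 1)) := by
  have hgap : ∀ j < N, gap (k j) ≠ 0 := fun j hj => sub_ne_zero.2 (hk j hj)
  have ind := dressed_isEigenfunction (Υ' := Υ') hgap hk_ne hΥ hS hS_conj hkS hq₀ hψ₀
  obtain ⟨hN, hGI, hopen, -, -⟩ := ind N le_rfl
  have unit : ∀ x t : ℝ, ∀ κ ∈ S \ poleSet k N, IsUnit (dressed k Υ Υ' (ψ₀ x t) N κ) :=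
    fun x t κ hκ => IsUnit.of_mul_eq_one _ (hN.unitarity x t κ hκ)
  refine ⟨fun j hj x t => ?_, fun x t κ hκS hκ => ⟨unit x t κ ⟨hκS, hκ⟩, fun a b => ?_⟩,
    fun x t p hp => ?_, ?_⟩
  · obtain ⟨h, -, -, -, hmem⟩ := ind j hj.le
    have hp := hmem j hj le_rfl
    exact ⟨fun s hs => delta_ne_zero _ s _ _ hs (hgap j hj) (h.yVec_ne_zero x t hp (hΥ j hj)),
      fun κ hκ => h.stepFactor_mul_inv (Υ' j) hp (hgap j hj) (hΥ j hj) x t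
        fun hq => hκ ⟨j, hj, hq⟩⟩
  · have hs := hN.smoothXT hopen ⟨hκS, hκ⟩ a b
    exact ⟨hs.differentiableAt_x x t, hs.differentiableAt_t x t⟩
  · have hpS := mem_of_mem_poleSet hS_neg hS_conj hkS hp
    exact ⟨analyticAfterRemoval_of_lax hS (poleSet_finite k N) hpS _ (unit x t)
        fun κ hκ => (hN.hasMatDeriv_x hopen x t hκ).realDeriv_eq,
      analyticAfterRemoval_of_lax hS (poleSet_finite k N) hpS _ (unit x t)
        fun κ hκ => (hN.hasMatDeriv_t hopen x t hκ).realDeriv_eq⟩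
  · choose A A' hA hsum using fun x t => dressingProduct_expansion (N := N) Υ Υ' (ψ₀ x t)
      (fun i hi j hj hij => (hk_ne i hi j hj hij).1) N le_rfl
    refine ⟨fun j x t => A x t j, fun j x t => A' x t j, hA, ?_⟩
    simp only [hsum]
    exact hGI
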